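/- Let $p_1,\dots,p_t$ be pairwise distinct odd primes, let $r_1,\dots,r_t\ge 1$, and put $m_j=p_j^{r_j}$, $q=m_1\cdots m_t$, $n_j=m_1+\cdots+m_j$ (so $n_0=0$) and $n=n_t$. Let $B_n$ be the Artin braid group with its standard generators $\sigma_1,\dots,\sigma_{n-1}$, let $P_n$ be the pure braid group, i.e. the kernel of the homomorphism $B_n\to S_n$, $\sigma_i\mapsto (i,\,i+1)$, and work in the group $B_n/[P_n,P_n]$. There put $$A_{i,j}=\sigma_{j-1}\cdots\sigma_{i+1}\,\sigma_i^2\,\sigma_{i+1}^{-1}\cdots\sigma_{j-1}^{-1}\qquad(1\le i<j\le n),$$ $$\delta_{a,m}=\sigma_{a+m-1}\cdots\sigma_{a+\frac{m+1}{2}}\;\sigma_{a+\frac{m-1}{2}}^{-1}\cdots\sigma_{a+1}^{-1}\quad(m\text{ odd}),\qquad \delta=\delta_{n_0,m_1}\,\delta_{n_1,m_2}\cdots\delta_{n_{t-1},m_t}.$$ Let $\Gamma_q$ be the subgroup of $B_n/[P_n,P_n]$ generated by the elements $A_{n_{j-1}+1,\,n_{j-1}+2}\,\delta_{n_{j-1},m_j}$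 for $1\le j\le t$ and the elements $A_{r,s}^{\,q}$ for $1\le r<s\le n$. Define - $e_{j,0,1}=\bigl(A_{n_{j-1}+1,\,n_{j-1}+2}\,\delta_{n_{j-1},m_j}\bigr)^{m_j}$ for $1\le j\le t$; - $e_{j,h,k}=\delta^{k-1}A_{n_{j-1}+1,\,n_{j-1}+h+2}^{\,q}\,\delta^{-(k-1)}$ for $1\le j\le t$, $1\le h\le \frac{m_j-3}{2}$, $1\le k\le m_j$; - $e_{t+j,\,t+l,\,k}=\delta^{k-1}A_{n_{j-1}+1,\,n_{l-1}+1}^{\,q}\,\delta^{-(k-1)}$ for $1\le j<l\le t$, $1\le k\le m_jm_l$. Then the center of $\Gamma_q$ is a free abelian group of rank $$\sum_{i=1}^t\frac{p_i^{r_i}-1}{2}+\frac{t(t-1)}{2},$$ and a basis of it is given by the elements $e_{j,0,1}$ $(1\le j\le t)$, the elements $\prod_{k=1}^{m_j}e_{j,h,k}$ $(1\le j\le t,\ 1\le h\le\frac{m_j-3}{2})$ and the elements $\prod_{k=1}^{m_jm_l}e_{t+j,\,t+l,\,k}$ $(1\le j<l\le t)$, where the members of this family, indexed as shown, are pairwise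 distinct. -/

import Mathlib

open scoped BigOperators IsMulCommutative

/-- The relators of the Artin presentation on `n` strings. The free generator with index
`i : Fin (n - 1)` (counted from `0`) is `σ_{i+1}`. -/
def braidRels (n : ℕ) : Set (FreeGroup (Fin (n - 1))) :=
  {w | ∃ i j : Fin (n - 1), (i : ℕ) + 2 ≤ (j : ℕ) ∧
      w = (FreeGroup.of i * FreeGroup.of j) * (FreeGroup.of j * FreeGroup.of i)⁻¹} ∪
  {w | ∃ i j : Fin (n - 1), (j : ℕ) = (i : ℕ) + 1 ∧
      w = (FreeGroup.of j * FreeGroup.of i * FreeGroup.of j) *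
        (FreeGroup.of i * FreeGroup.of j * FreeGroup.of i)⁻¹}

/-- The Artin braid group `B_n`. -/
abbrev BraidGroup (n : ℕ) : Type := PresentedGroup (braidRels n)

/-- The transposition of the two strings crossed by a generator of `B_n`. -/
def braidSwap (n : ℕ) (i : Fin (n - 1)) : Equiv.Perm (Fin n) :=
  Equiv.swap ⟨i, by omega⟩ ⟨i + 1, by omega⟩

theorem braidSwap_rels (n : ℕ) :
    ∀ w ∈ braidRels n, FreeGroup.lift (braidSwap n) w = 1 := by
  rintro w (⟨i, j, hij, rfl⟩ | ⟨i, j, hij, rfl⟩)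
  · simp only [map_mul, map_inv, FreeGroup.lift_apply_of, mul_inv_eq_one]
    ext x
    simp only [braidSwap, Equiv.Perm.mul_apply, Equiv.swap_apply_def, Fin.ext_iff]
    grind
  · simp only [map_mul, map_inv, FreeGroup.lift_apply_of, mul_inv_eq_one]
    ext x
    simp only [braidSwap, Equiv.Perm.mul_apply, Equiv.swap_apply_def, Fin.ext_iff]
    grind

/-- The homomorphism `B_n → S_n` sending `σ_i` to the transposition `(i, i + 1)`. -/
def braidPerm (n : ℕ) : BraidGroup n →* Equiv.Perm (Fin n) :=
  PresentedGroup.toGroup (braidSwap_rels n)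

/-- The pure braid group `P_n`, as a subgroup of `B_n`. -/
def pureBraid (n : ℕ) : Subgroup (BraidGroup n) := (braidPerm n).ker

instance pureBraid_normal (n : ℕ) : (pureBraid n).Normal :=
  inferInstanceAs (braidPerm n).ker.Normal

/-- The quotient `B_n / [P_n, P_n]`. -/
abbrev BraidQuot (n : ℕ) : Type := BraidGroup n ⧸ ⁅pureBraid n, pureBraid n⁆

/-- The class of `σ_i` in `B_n / [P_n, P_n]`, for `1 ≤ i ≤ n - 1` (and `1` for other `i`,
which never occur below). -/
def sigmaQ (n i : ℕ) : BraidQuot n :=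
  if h : 1 ≤ i ∧ i ≤ n - 1 then
    QuotientGroup.mk (PresentedGroup.of (⟨i - 1, by omega⟩ : Fin (n - 1)))
  else 1

/-- The class of `A_{i,j} = σ_{j-1} ⋯ σ_{i+1} σ_i² σ_{i+1}⁻¹ ⋯ σ_{j-1}⁻¹`, for
`1 ≤ i < j ≤ n`. -/
def pureA (n i j : ℕ) : BraidQuot n :=
  ((List.range (j - i - 1)).map fun s => sigmaQ n (j - 1 - s)).prod * sigmaQ n i ^ 2 *
    (((List.range (j - i - 1)).map fun s => sigmaQ n (j - 1 - s)).prod)⁻¹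

/-- The class of `δ_{a,m} = σ_{a+m-1} ⋯ σ_{a+(m+1)/2} σ_{a+(m-1)/2}⁻¹ ⋯ σ_{a+1}⁻¹`, for odd
`m` and `a + m ≤ n`. -/
def deltaBlock (n a m : ℕ) : BraidQuot n :=
  ((List.range ((m - 1) / 2)).map fun s => sigmaQ n (a + m - 1 - s)).prod *
    ((List.range ((m - 1) / 2)).map fun s => (sigmaQ n (a + (m - 1) / 2 - s))⁻¹).prod

section Blocks

/-- The number of strings `n = m_1 + ⋯ + m_t` for block sizes `m_1, …, m_t`. -/
def numStrings {t : ℕ} (m : Fin t → ℕ) : ℕ := ∑ i, m i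

/-- The number of strings in the blocks before the block `j`. -/
def blockStart {t : ℕ} (m : Fin t → ℕ) (j : Fin t) : ℕ := ∑ i ∈ Finset.Iio j, m i

/-- The product `q` of the block sizes. -/
def holonomyOrder {t : ℕ} (m : Fin t → ℕ) : ℕ := ∏ i, m i

/-- The product over all blocks, in increasing order, of the elements `δ_{a,m}`. -/
def deltaAll {t : ℕ} (m : Fin t → ℕ) : BraidQuot (numStrings m) :=
  (List.ofFn fun j : Fin t => deltaBlock (numStrings m) (blockStart m j) (m j)).prod

/-- The element `A_{a+1,a+2} δ_{a,m_j}`, where `a` strings precede the block `j`. -/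
def blockGen {t : ℕ} (m : Fin t → ℕ) (j : Fin t) : BraidQuot (numStrings m) :=
  pureA (numStrings m) (blockStart m j + 1) (blockStart m j + 2) *
    deltaBlock (numStrings m) (blockStart m j) (m j)

/-- The group `Γ_q`: the subgroup of `B_n / [P_n, P_n]` generated by the elements `blockGen`
and by the powers `A_{r,s}^q`, `1 ≤ r < s ≤ n`. -/
def GammaQ {t : ℕ} (m : Fin t → ℕ) : Subgroup (BraidQuot (numStrings m)) :=
  Subgroup.closure
    (Set.range (blockGen m) ∪
      {x | ∃ r s : ℕ, 1 ≤ r ∧ r < s ∧ s ≤ numStrings m ∧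
        x = pureA (numStrings m) r s ^ holonomyOrder m})

/-- The element `e_{j,0,1}`. -/
def eFixed {t : ℕ} (m : Fin t → ℕ) (j : Fin t) : BraidQuot (numStrings m) :=
  blockGen m j ^ m j

/-- The elements `e_{j,h,k}` for a block `j`, with `1 ≤ h ≤ (m_j - 3) / 2` and
`1 ≤ k ≤ m_j`. -/
def eBlock {t : ℕ} (m : Fin t → ℕ) (j : Fin t) (h k : ℕ) : BraidQuot (numStrings m) :=
  deltaAll m ^ (k - 1) *
    pureA (numStrings m) (blockStart m j + 1) (blockStart m j + h + 2) ^ holonomyOrder m *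
    (deltaAll m ^ (k - 1))⁻¹

/-- The elements `e_{t+j,t+l,k}` for two blocks `j < l`, with `1 ≤ k ≤ m_j m_l`. -/
def eCross {t : ℕ} (m : Fin t → ℕ) (j l : Fin t) (k : ℕ) : BraidQuot (numStrings m) :=
  deltaAll m ^ (k - 1) *
    pureA (numStrings m) (blockStart m j + 1) (blockStart m l + 1) ^ holonomyOrder m *
    (deltaAll m ^ (k - 1))⁻¹

/-- The index set of the orbits: the blocks `j`, the pairs `(j, h)` with
`1 ≤ h ≤ (m_j - 3) / 2`, and the pairs of blocks `j < l`. -/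
abbrev OrbitIndex {t : ℕ} (m : Fin t → ℕ) : Type :=
  Fin t ⊕ (Σ j : Fin t, Finset.Icc 1 ((m j - 3) / 2)) ⊕ {x : Fin t × Fin t // x.1 < x.2}

/-- The product of the elements of each orbit, in increasing order of `k`. -/
def orbitProd {t : ℕ} (m : Fin t → ℕ) : OrbitIndex m → BraidQuot (numStrings m)
  | Sum.inl j => eFixed m j
  | Sum.inr (Sum.inl x) => ((List.range' 1 (m x.1)).map fun k => eBlock m x.1 x.2 k).prod
  | Sum.inr (Sum.inr x) =>
      ((List.range' 1 (m x.1.1 * m x.1.2)).map fun k => eCross m x.1.1 x.1.2 k).prod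

end Blocks

/-! `LinkGroup` is a semidirect product of permutations and integer functions on pairs of points;
`linkHom` records the permutation and the signed crossings of a class. It is injective
(`linkHom_injective`): modulo the subgroup generated by the `A_{i,j}` the `σ_i` satisfy the Coxeter
relations, so this subgroup consists of all pure classes (`mem_pureClosure_iff`), and crossing
numbers read off the exponent of each `A_{i,j}`. Everything becomes a computation with permutations
and functions.

The crossing function of each block rotation is a coboundary. After conjugation by one suitable
function (`blockHom`), all block rotations are bare permutations. A pure element commutes with `h`
exactly if its crossing function is invariant under the permutation of `h` (`mul_comm_iff`). A
central element of `Γ_q` commutes with every `A_{r,s}^q`, so its permutation preserves every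
two-element set of strings and is trivial (`perm_eq_one`). By the Chinese remainder theorem each
block rotation acts as a power of `δ`. Hence the center consists of the pure elements of `Γ_q` whose
crossing function is constant on the `δ`-orbits of unordered pairs. There is one orbit for each
cyclic distance `1 ≤ d ≤ (m_j - 1)/2` inside a block and, by coprimality, one for each two blocks
(`orbit_unique`, `orbit_cover`).

The listed central element of an orbit has crossing number 2 (for `d = 1`) or `2q` (otherwise) there
and 0 on the other orbits. Conversely, pure elements of `Γ_q` have even crossing numbers, and
multiples of `2q` away from cyclic neighbours (`weight_dvd`). So evaluation at representatives is
dual to the family up to exactly these weights, which makes the family a basis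
(`exists_basis_of_eval`). -/

set_option linter.unusedSimpArgs false

/-! ### Artin relations in the quotient. -/

section SigmaRelations

variable {n : ℕ}

theorem sigmaQ_succ (i : Fin (n - 1)) :
    sigmaQ n (i + 1) = QuotientGroup.mk (PresentedGroup.of i) := by
  have : 1 ≤ (i : ℕ) + 1 ∧ (i : ℕ) + 1 ≤ n - 1 := ⟨by omega, by omega⟩
  simp [sigmaQ, this]

/-- Out of range `sigmaQ` is `1`, so far commutation needs no bounds, unlike the braid relation. -/
theorem sigmaQ_comm {i j : ℕ} (h : i + 2 ≤ j) :
    sigmaQ n i * sigmaQ n j = sigmaQ n j * sigmaQ n i := by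
  by_cases hi : 1 ≤ i ∧ i ≤ n - 1
  · by_cases hj : 1 ≤ j ∧ j ≤ n - 1
    · simp only [sigmaQ, hi, hj, and_self, dif_pos]
      rw [← QuotientGroup.mk_mul, ← QuotientGroup.mk_mul]
      congr 1
      rw [← mul_inv_eq_one]
      exact PresentedGroup.one_of_mem
        (rels := braidRels n) (Or.inl ⟨⟨i - 1, by omega⟩, ⟨j - 1, by omega⟩, by simp; omega, rfl⟩)
    · simp [sigmaQ, hj]
  · simp [sigmaQ, hi]

theorem sigmaQ_braid {i : ℕ} (hi : 1 ≤ i) (hn : i + 1 ≤ n - 1) :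
    sigmaQ n (i + 1) * sigmaQ n i * sigmaQ n (i + 1) =
      sigmaQ n i * sigmaQ n (i + 1) * sigmaQ n i := by
  have h1 : 1 ≤ i ∧ i ≤ n - 1 := by omega
  have h2 : 1 ≤ i + 1 ∧ i + 1 ≤ n - 1 := by omega
  simp only [sigmaQ, h1, h2, and_self, dif_pos]
  simp only [← QuotientGroup.mk_mul]
  congr 1
  rw [← mul_inv_eq_one]
  exact PresentedGroup.one_of_mem
    (rels := braidRels n) (Or.inr ⟨⟨i - 1, by omega⟩, ⟨i + 1 - 1, by omega⟩, by simp; omega, rfl⟩)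

theorem closure_sigmaQ (n : ℕ) :
    Subgroup.closure {x | ∃ i, 1 ≤ i ∧ i ≤ n - 1 ∧ x = sigmaQ n i} = ⊤ := by
  have h := PresentedGroup.closure_range_of (braidRels n)
  have h2 := congrArg (Subgroup.map (QuotientGroup.mk' ⁅pureBraid n, pureBraid n⁆)) h
  rw [MonoidHom.map_closure, Subgroup.map_top_of_surjective _ (QuotientGroup.mk'_surjective _)] at h2
  rw [eq_top_iff, ← h2]
  apply Subgroup.closure_mono
  rintro _ ⟨_, ⟨i, rfl⟩, rfl⟩
  exact ⟨i + 1, by omega, by omega, (sigmaQ_succ i).symm⟩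

end SigmaRelations

/-! ### Permutations with crossing numbers. -/

/-- Permutations of the natural numbers together with an integer for every ordered pair of
points, which records signed crossings; multiplication adds crossings along strands. -/
@[ext]
structure LinkGroup where
  perm : Equiv.Perm ℕ
  cr : ℕ → ℕ → ℤ

namespace LinkGroup

instance : Mul LinkGroup :=
  ⟨fun g h => ⟨g.perm * h.perm, fun x y => g.cr (h.perm x) (h.perm y) + h.cr x y⟩⟩

instance : One LinkGroup := ⟨⟨1, fun _ _ => 0⟩⟩

instance : Inv LinkGroup :=
  ⟨fun g => ⟨g.perm⁻¹, fun x y => -g.cr (g.perm⁻¹ x) (g.perm⁻¹ y)⟩⟩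

@[simp] theorem mul_perm (g h : LinkGroup) : (g * h).perm = g.perm * h.perm := rfl
@[simp] theorem mul_cr (g h : LinkGroup) (x y : ℕ) :
    (g * h).cr x y = g.cr (h.perm x) (h.perm y) + h.cr x y := rfl
@[simp] theorem one_perm : (1 : LinkGroup).perm = 1 := rfl
@[simp] theorem one_cr (x y : ℕ) : (1 : LinkGroup).cr x y = 0 := rfl
@[simp] theorem inv_perm (g : LinkGroup) : g⁻¹.perm = g.perm⁻¹ := rfl
@[simp] theorem inv_cr (g : LinkGroup) (x y : ℕ) :
    g⁻¹.cr x y = -g.cr (g.perm⁻¹ x) (g.perm⁻¹ y) := rfl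

instance : Group LinkGroup :=
  Group.ofLeftAxioms
    (fun a b c => by ext <;> simp [add_assoc])
    (fun a => by ext <;> simp)
    (fun a => by ext <;> simp)

/-- The projection to the underlying permutation. -/
def permHom : LinkGroup →* Equiv.Perm ℕ where
  toFun := perm
  map_one' := rfl
  map_mul' _ _ := rfl

@[simp] theorem permHom_apply (g : LinkGroup) : permHom g = g.perm := rfl

@[simp] theorem pow_perm (g : LinkGroup) (k : ℕ) : (g ^ k).perm = g.perm ^ k :=
  map_pow permHom g k

theorem mul_comm_of_perm {g h : LinkGroup} (hg : g.perm = 1) (hh : h.perm = 1) :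
    g * h = h * g := by
  ext <;> simp [hg, hh, add_comm]

/-- The indicator of an unordered pair. -/
def pairInd (r s x y : ℕ) : ℤ := if (x = r ∧ y = s) ∨ (x = s ∧ y = r) then 1 else 0

theorem pairInd_perm (π : Equiv.Perm ℕ) (r s x y : ℕ) :
    pairInd r s (π x) (π y) = pairInd (π⁻¹ r) (π⁻¹ s) x y := by
  simp only [pairInd, Equiv.Perm.eq_inv_iff_eq]

theorem pairInd_swap (r s x y : ℕ) : pairInd r s x y = pairInd s r x y := by
  simp only [pairInd]
  congr 1
  grind

/-- One crossing, with sign `ε`, of the strands in positions `i` and `i + 1`. -/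
def crossing (ε : ℤ) (i : ℕ) : LinkGroup := ⟨Equiv.swap i (i + 1), fun x y => ε * pairInd i (i + 1) x y⟩

theorem crossing_inv (i : ℕ) : (crossing 1 i)⁻¹ = crossing (-1) i := by
  ext x
  · simp [crossing]
  · rename_i y
    simp only [crossing, inv_cr, Equiv.swap_inv, Equiv.swap_apply_def, pairInd]
    grind

theorem crossing_comm {i j : ℕ} (h : i + 2 ≤ j) :
    crossing 1 i * crossing 1 j = crossing 1 j * crossing 1 i := by
  ext x
  · simp only [crossing, mul_perm, Equiv.Perm.mul_apply, Equiv.swap_apply_def]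
    grind
  · rename_i y
    simp only [crossing, mul_cr, pairInd_perm, Equiv.swap_inv]
    rw [Equiv.swap_apply_of_ne_of_ne, Equiv.swap_apply_of_ne_of_ne,
      Equiv.swap_apply_of_ne_of_ne, Equiv.swap_apply_of_ne_of_ne, add_comm] <;> omega

/-- Both sides cross each of the three pairs of strands exactly once, in opposite orders. -/
theorem crossing_braid (i : ℕ) :
    crossing 1 (i + 1) * crossing 1 i * crossing 1 (i + 1) =
      crossing 1 i * crossing 1 (i + 1) * crossing 1 i := by
  have h1 : Equiv.swap i (i + 1) (i + 1 + 1) = i + 1 + 1 :=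
    Equiv.swap_apply_of_ne_of_ne (by omega) (by omega)
  have h2 : Equiv.swap (i + 1) (i + 1 + 1) i = i :=
    Equiv.swap_apply_of_ne_of_ne (by omega) (by omega)
  ext x
  · simp only [crossing, mul_perm, Equiv.Perm.mul_apply, Equiv.swap_apply_def]
    grind
  · rename_i y
    simp only [crossing, mul_cr, pairInd_perm, Equiv.swap_inv, h1, h2, Equiv.swap_apply_left,
      Equiv.swap_apply_right]
    ring

end LinkGroup

/-! ### The crossing homomorphism on the braid group and its quotient. -/

open LinkGroup

theorem crossing_rels (n : ℕ) : ∀ w ∈ braidRels n,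
    FreeGroup.lift (fun i : Fin (n - 1) => crossing 1 ((i : ℕ) + 1)) w = 1 := by
  rintro w (⟨i, j, hij, rfl⟩ | ⟨i, j, hij, rfl⟩)
  · simp only [map_mul, map_inv, FreeGroup.lift_apply_of, mul_inv_eq_one]
    exact crossing_comm (by omega)
  · simp only [map_mul, map_inv, FreeGroup.lift_apply_of, mul_inv_eq_one]
    rw [hij]
    exact crossing_braid _

/-- The signed crossings of a braid. -/
def braidLink (n : ℕ) : BraidGroup n →* LinkGroup := PresentedGroup.toGroup (crossing_rels n)

/-- The embedding shifts by one: strings are `1, …, n` in `LinkGroup`, but `Fin n` starts at `0`. -/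
theorem braidLink_perm {n : ℕ} (g : BraidGroup n) :
    (braidLink n g).perm = (braidPerm n g).viaEmbedding
      ⟨fun x : Fin n => (x : ℕ) + 1, fun x y h => by simpa [Fin.ext_iff] using h⟩ := by
  set ι : Fin n ↪ ℕ := ⟨fun x : Fin n => (x : ℕ) + 1, fun x y h => by simpa [Fin.ext_iff] using h⟩
  have hι : ∀ x, ι x = (x : ℕ) + 1 := fun x => rfl
  suffices h : permHom.comp (braidLink n) =
      (Equiv.Perm.viaEmbeddingHom ι).comp (braidPerm n) from DFunLike.congr_fun h g
  apply PresentedGroup.ext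
  intro i
  ext x
  simp only [MonoidHom.comp_apply, braidLink, braidPerm, PresentedGroup.toGroup.of, permHom_apply,
    crossing, Equiv.Perm.viaEmbeddingHom_apply]
  by_cases hx : x ∈ Set.range ι
  · obtain ⟨y, rfl⟩ := hx
    rw [Equiv.Perm.viaEmbedding_apply]
    simp only [braidSwap, Equiv.swap_apply_def, Fin.ext_iff, hι]
    split_ifs <;> simp <;> omega
  · rw [Equiv.Perm.viaEmbedding_apply_of_notMem _ _ _ hx]
    apply Equiv.swap_apply_of_ne_of_ne
    · rintro rfl
      exact hx ⟨⟨i, by omega⟩, rfl⟩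
    · rintro rfl
      exact hx ⟨⟨i + 1, by omega⟩, rfl⟩

theorem braidLink_perm_eq_one {n : ℕ} {g : BraidGroup n} :
    (braidLink n g).perm = 1 ↔ g ∈ pureBraid n := by
  rw [braidLink_perm, pureBraid, MonoidHom.mem_ker]
  exact map_eq_one_iff (Equiv.Perm.viaEmbeddingHom _) (Equiv.Perm.viaEmbeddingHom_injective _)

/-- The signed crossings of a class in `B_n / [P_n, P_n]`. -/
def linkHom (n : ℕ) : BraidQuot n →* LinkGroup :=
  QuotientGroup.lift _ (braidLink n) fun g hg => by
    have : ⁅pureBraid n, pureBraid n⁆ ≤ (braidLink n).ker := by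
      rw [Subgroup.commutator_le]
      intro g hg h hh
      rw [MonoidHom.mem_ker, map_commutatorElement, commutatorElement_eq_one_iff_mul_comm]
      exact mul_comm_of_perm (braidLink_perm_eq_one.2 hg) (braidLink_perm_eq_one.2 hh)
    exact this hg

theorem linkHom_sigmaQ {n i : ℕ} (h : 1 ≤ i) (hn : i ≤ n - 1) :
    linkHom n (sigmaQ n i) = crossing 1 i := by
  obtain ⟨k, rfl⟩ : ∃ k : Fin (n - 1), i = k + 1 := ⟨⟨i - 1, by omega⟩, by simp; omega⟩
  rw [sigmaQ_succ]
  simp [linkHom, braidLink]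

theorem pure_mul_comm {n : ℕ} {g h : BraidQuot n} (hg : (linkHom n g).perm = 1)
    (hh : (linkHom n h).perm = 1) : g * h = h * g := by
  induction g using QuotientGroup.induction_on with | H g => ?_
  induction h using QuotientGroup.induction_on with | H h => ?_
  rw [← commutatorElement_eq_one_iff_mul_comm]
  refine (QuotientGroup.eq_one_iff _).2 (Subgroup.commutator_mem_commutator ?_ ?_)
  · exact braidLink_perm_eq_one.1 hg
  · exact braidLink_perm_eq_one.1 hh

/-! ### Conjugation of the `A_{i,j}` by the `σ_k`, and normality of the subgroup they generate. -/

section PureGenerators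

variable {n : ℕ}

theorem pureA_self_succ (n i : ℕ) : pureA n i (i + 1) = sigmaQ n i ^ 2 := by
  simp [pureA]

theorem pureA_succ {i j : ℕ} (h : i < j) :
    pureA n i (j + 1) = MulAut.conj (sigmaQ n j) (pureA n i j) := by
  obtain ⟨d, rfl⟩ : ∃ d, j = i + 1 + d := ⟨j - (i + 1), by omega⟩
  have h1 : i + 1 + d + 1 - i - 1 = d + 1 := by omega
  have h2 : i + 1 + d - i - 1 = d := by omega
  have h3 : ∀ s, i + 1 + d + 1 - 1 - (s + 1) = i + 1 + d - 1 - s := fun s => by omega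
  simp only [pureA, h1, h2, List.range_succ_eq_map, List.map_cons, List.map_map, List.prod_cons,
    Function.comp_def, h3, MulAut.conj_apply, Nat.succ_eq_add_one]
  simp [mul_assoc]

theorem linkHom_pureA {i j : ℕ} (hi : 1 ≤ i) (hij : i < j) (hj : j ≤ n) :
    linkHom n (pureA n i j) = ⟨1, fun x y => 2 * pairInd i j x y⟩ := by
  induction j, hij using Nat.le_induction with
  | base =>
    rw [Nat.succ_eq_add_one, pureA_self_succ, map_pow, linkHom_sigmaQ hi (by omega), pow_two]
    ext x
    · simp [crossing]
    · simp only [crossing, mul_cr, pairInd_perm, Equiv.swap_inv, Equiv.swap_apply_left,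
        Equiv.swap_apply_right]
      rw [pairInd_swap (i + 1)]
      ring
  | succ j hij ih =>
    rw [pureA_succ hij, MulAut.conj_apply, map_mul, map_mul, ih (by omega), map_inv,
      linkHom_sigmaQ (by omega) (by omega)]
    ext x
    · simp
    · simp only [crossing, mul_cr, inv_cr, inv_perm, pairInd_perm, Equiv.swap_inv, Equiv.Perm.one_apply,
        Equiv.swap_apply_left]
      rw [Equiv.swap_apply_of_ne_of_ne (show i ≠ j by omega) (by omega)]
      ring

theorem pureA_pure {i j : ℕ} (hi : 1 ≤ i) (hij : i < j) (hj : j ≤ n) :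
    (linkHom n (pureA n i j)).perm = 1 := by rw [linkHom_pureA hi hij hj]

/-- `σ_k² = A_{k,k+1}` is pure and pure classes commute, so conjugation by `σ_k` is an involution on
them. This makes conjugation by `σ_k⁻¹` superfluous below. -/
theorem conj_sigmaQ_conj {k : ℕ} (hk : 1 ≤ k) (hkn : k ≤ n - 1) {x : BraidQuot n}
    (hx : (linkHom n x).perm = 1) :
    MulAut.conj (sigmaQ n k) (MulAut.conj (sigmaQ n k) x) = x := by
  have h := pure_mul_comm (pureA_pure (n := n) hk (Nat.lt_succ_self k) (by omega)) hx
  rw [pureA_self_succ] at h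
  rw [← MulAut.mul_apply, ← map_mul, ← pow_two, MulAut.conj_apply, h, mul_inv_cancel_right]

theorem conj_eq_self_iff {G : Type*} [Group G] {g x : G} :
    MulAut.conj g x = x ↔ g * x = x * g := by
  rw [MulAut.conj_apply, mul_inv_eq_iff_eq_mul]

theorem conj_conj_comm {G : Type*} [Group G] {g h : G} (x : G) (hgh : g * h = h * g) :
    MulAut.conj g (MulAut.conj h x) = MulAut.conj h (MulAut.conj g x) := by
  rw [← MulAut.mul_apply, ← MulAut.mul_apply, ← map_mul, ← map_mul, hgh]

theorem conj_sigmaQ_pureA_above {i j k : ℕ} (hij : i < j) (hk : j + 1 ≤ k) :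
    MulAut.conj (sigmaQ n k) (pureA n i j) = pureA n i j := by
  induction j, hij using Nat.le_induction with
  | base =>
    have : Commute (sigmaQ n k) (sigmaQ n i) := (sigmaQ_comm (by omega)).symm
    rw [Nat.succ_eq_add_one, pureA_self_succ, conj_eq_self_iff]
    exact this.pow_right 2
  | succ j hij ih =>
    rw [pureA_succ hij, conj_conj_comm _ (sigmaQ_comm (by omega)).symm, ih (by omega)]

theorem conj_sigmaQ_pureA_below {i j k : ℕ} (hij : i < j) (hk : k + 2 ≤ i) :
    MulAut.conj (sigmaQ n k) (pureA n i j) = pureA n i j := by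
  induction j, hij using Nat.le_induction with
  | base =>
    have : Commute (sigmaQ n k) (sigmaQ n i) := sigmaQ_comm (by omega)
    rw [Nat.succ_eq_add_one, pureA_self_succ, conj_eq_self_iff]
    exact this.pow_right 2
  | succ j hij ih =>
    rw [pureA_succ hij, conj_conj_comm _ (sigmaQ_comm (by omega)), ih]

/-- In the base case the braid relation gives the identity with `σ_{k+1}⁻¹` in place of `σ_{k+1}`;
the two agree only because `σ_{k+1}²` commutes with pure classes. -/
theorem conj_sigmaQ_pureA_left {j k : ℕ} (hk : 1 ≤ k) (hij : k + 1 < j) (hj : j ≤ n) :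
    MulAut.conj (sigmaQ n k) (pureA n (k + 1) j) = pureA n k j := by
  induction j, hij using Nat.le_induction with
  | base =>
    have h : MulAut.conj (sigmaQ n (k + 1)) (MulAut.conj (sigmaQ n k) (sigmaQ n (k + 1) ^ 2)) =
        sigmaQ n k ^ 2 := by
      rw [← MulAut.mul_apply, ← map_mul, map_pow]
      congr 1
      rw [MulAut.conj_apply, sigmaQ_braid hk (by omega)]
      group
    rw [Nat.succ_eq_add_one, pureA_succ (Nat.lt_succ_self k), pureA_self_succ, pureA_self_succ, ← h,
      conj_sigmaQ_conj (by omega) (by omega)]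
    have := pureA_pure (n := n) (i := k + 1) (by omega) (Nat.lt_succ_self _) (by omega)
    rw [pureA_self_succ] at this
    rw [MulAut.conj_apply, map_mul, map_mul, map_inv, mul_perm, mul_perm, this]
    simp
  | succ j hij ih =>
    rw [pureA_succ (by omega), conj_conj_comm _ (sigmaQ_comm (by omega)), ih (by omega),
      ← pureA_succ (by omega)]

theorem conj_sigmaQ_pureA_mid {i j k : ℕ} (hi : 1 ≤ i) (hik : i < k) (hkj : k + 1 < j)
    (hj : j ≤ n) : MulAut.conj (sigmaQ n k) (pureA n i j) = pureA n i j := by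
  induction j, hkj using Nat.le_induction with
  | base =>
    rw [Nat.succ_eq_add_one, pureA_succ (by omega), pureA_succ hik]
    -- Since `σ_{k+1}` fixes `A_{i,k}`, it can be inserted on the right to complete a braid
    -- relation.
    have h := conj_sigmaQ_pureA_above (n := n) hik (le_refl (k + 1))
    conv_rhs => rw [← h]
    simp only [← MulAut.mul_apply, ← map_mul]
    rw [← mul_assoc, ← sigmaQ_braid (by omega) (by omega), mul_assoc]
  | succ j hij ih =>
    rw [pureA_succ (by omega), conj_conj_comm _ (sigmaQ_comm (by omega)), ih (by omega)]

/-- The subgroup of `B_n / [P_n, P_n]` generated by the `A_{i,j}`. -/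
def pureClosure (n : ℕ) : Subgroup (BraidQuot n) :=
  Subgroup.closure {x | ∃ i j, 1 ≤ i ∧ i < j ∧ j ≤ n ∧ x = pureA n i j}

theorem pureA_mem {i j : ℕ} (hi : 1 ≤ i) (hij : i < j) (hj : j ≤ n) :
    pureA n i j ∈ pureClosure n :=
  Subgroup.subset_closure ⟨i, j, hi, hij, hj, rfl⟩

theorem conj_sigmaQ_pureA_mem {i j k : ℕ} (hk : 1 ≤ k) (hkn : k ≤ n - 1) (hi : 1 ≤ i)
    (hij : i < j) (hj : j ≤ n) :
    MulAut.conj (sigmaQ n k) (pureA n i j) ∈ pureClosure n := by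
  rcases lt_or_ge j k with h | h
  · rw [conj_sigmaQ_pureA_above hij h]
    exact pureA_mem hi hij hj
  rcases h.eq_or_lt with rfl | h
  · rw [← pureA_succ hij]
    exact pureA_mem hi (by omega) (by omega)
  rcases lt_or_ge (k + 1) i with h1 | h1
  · rw [conj_sigmaQ_pureA_below hij h1]
    exact pureA_mem hi hij hj
  rcases h1.eq_or_lt with rfl | h1
  · rw [conj_sigmaQ_pureA_left hk hij hj]
    exact pureA_mem hk (by omega) hj
  rcases (Nat.succ_le_of_lt h).eq_or_lt with rfl | h2
  · rcases (Nat.lt_succ_iff.1 h1).eq_or_lt with rfl | h3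
    · have : MulAut.conj (sigmaQ n i) (pureA n i i.succ) = pureA n i i.succ := by
        rw [Nat.succ_eq_add_one, pureA_self_succ, conj_eq_self_iff]
        exact ((Commute.refl _).pow_right 2)
      rw [this]
      exact pureA_mem hi hij hj
    · rw [Nat.succ_eq_add_one, pureA_succ h3,
        conj_sigmaQ_conj hk hkn (pureA_pure hi h3 (by omega))]
      exact pureA_mem hi h3 (by omega)
  · rcases (Nat.lt_succ_iff.1 h1).eq_or_lt with rfl | h3
    · rw [← conj_sigmaQ_pureA_left hi h2 hj,
        conj_sigmaQ_conj hk hkn (pureA_pure (by omega) h2 (by omega))]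
      exact pureA_mem (by omega) h2 (by omega)
    · rw [conj_sigmaQ_pureA_mid hi h3 h2 hj]
      exact pureA_mem hi hij hj

theorem pureClosure_pure {g : BraidQuot n} (hg : g ∈ pureClosure n) :
    (linkHom n g).perm = 1 := by
  have : pureClosure n ≤ (permHom.comp (linkHom n)).ker := by
    rw [pureClosure, Subgroup.closure_le]
    rintro _ ⟨i, j, hi, hij, hj, rfl⟩
    exact pureA_pure hi hij hj
  exact this hg

theorem conj_sigmaQ_mem {k : ℕ} (hk : 1 ≤ k) (hkn : k ≤ n - 1) {x : BraidQuot n}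
    (hx : x ∈ pureClosure n) : MulAut.conj (sigmaQ n k) x ∈ pureClosure n := by
  have : pureClosure n ≤ (pureClosure n).comap (MulAut.conj (sigmaQ n k)).toMonoidHom := by
    conv_lhs => rw [pureClosure]
    rw [Subgroup.closure_le]
    rintro _ ⟨i, j, hi, hij, hj, rfl⟩
    exact conj_sigmaQ_pureA_mem hk hkn hi hij hj
  exact this hx

instance pureClosure_normal (n : ℕ) : (pureClosure n).Normal := by
  rw [← Subgroup.normalizer_eq_top_iff, eq_top_iff, ← closure_sigmaQ, Subgroup.closure_le]
  rintro _ ⟨k, hk, hkn, rfl⟩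
  rw [SetLike.mem_coe, Subgroup.mem_normalizer_iff]
  refine fun x => ⟨fun hx => conj_sigmaQ_mem hk hkn hx, fun hx => ?_⟩
  have h := conj_sigmaQ_mem hk hkn hx
  -- Purity passes from the conjugate back to `x`, so conjugating once more returns `x` itself.
  have hp := pureClosure_pure hx
  rw [← MulAut.conj_apply, conj_sigmaQ_conj hk hkn] at h
  · exact h
  · simp only [map_mul, map_inv, mul_perm, inv_perm] at hp
    have := congrArg (MulAut.conj (linkHom n (sigmaQ n k)).perm⁻¹) hp
    simpa [MulAut.conj_apply, mul_assoc] using this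

end PureGenerators

/-! ### Coxeter relations and the generation of the pure classes. -/

/-- Elements satisfying the relations of the Coxeter presentation of a symmetric group generate
a group that is mapped injectively by any homomorphism under which they become the simple
transpositions. -/
theorem coxeter_injective {G : Type*} [Group G] (s : ℕ → G) (ρ : G →* Equiv.Perm ℕ) (k : ℕ)
    (hρ : ∀ i, 1 ≤ i → i ≤ k → ρ (s i) = Equiv.swap i (i + 1))
    (hsq : ∀ i, 1 ≤ i → i ≤ k → s i * s i = 1)
    (hcomm : ∀ i j, 1 ≤ i → i + 2 ≤ j → j ≤ k → s i * s j = s j * s i)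
    (hbraid : ∀ i, 1 ≤ i → i + 1 ≤ k → s (i + 1) * s i * s (i + 1) = s i * s (i + 1) * s i)
    {g : G} (hg : g ∈ Subgroup.closure {x | ∃ i, 1 ≤ i ∧ i ≤ k ∧ x = s i}) (h1 : ρ g = 1) :
    g = 1 := by
  induction k generalizing g with
  | zero =>
    have : {x | ∃ i, 1 ≤ i ∧ i ≤ 0 ∧ x = s i} = ∅ := by
      ext x; simp
    rw [this, Subgroup.closure_empty] at hg
    exact hg
  | succ k ih =>
    set K := Subgroup.closure {x | ∃ i, 1 ≤ i ∧ i ≤ k ∧ x = s i} with hK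
    have hsK : ∀ i, 1 ≤ i → i ≤ k → s i ∈ K := fun i h h' => Subgroup.subset_closure ⟨i, h, h', rfl⟩
    -- the coset representatives `c d = s (k + 1) ⋯ s (k + 2 - d)`
    let c : ℕ → G := fun d => Nat.rec 1 (fun e x => x * s (k + 1 - e)) d
    have c0 : c 0 = 1 := rfl
    have cS : ∀ d, c (d + 1) = c d * s (k + 1 - d) := fun d => rfl
    have hcl : ∀ d i, 1 ≤ i → i + d ≤ k → c d * s i = s i * c d := by
      intro d
      induction d with
      | zero => intro i _ _; rw [c0, one_mul, mul_one]
      | succ d ihd =>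
        intro i hi hid
        rw [cS, mul_assoc, ← hcomm i _ hi (by omega) (by omega), ← mul_assoc, ihd i hi (by omega),
          mul_assoc]
    have hch : ∀ d i, d ≤ k + 1 → k + 2 < i + d → i ≤ k + 1 → c d * s i = s (i - 1) * c d := by
      intro d
      induction d with
      | zero => intro i _ _ _; omega
      | succ d ihd =>
        intro i hd hid hik
        rw [cS]
        rcases Nat.lt_or_ge (k + 2) (i + d) with h | h
        · rw [mul_assoc, hcomm (k + 1 - d) i (by omega) (by omega) hik, ← mul_assoc,
            ihd i (by omega) h hik, mul_assoc]
        · obtain ⟨e, rfl⟩ : ∃ e, d = e + 1 := ⟨d - 1, by omega⟩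
          obtain ⟨l, rfl⟩ : ∃ l, i = l + 1 := ⟨i - 1, by omega⟩
          have e1 : k + 1 - (e + 1) = l := by omega
          have e2 : k + 1 - e = l + 1 := by omega
          rw [cS, e1, e2, Nat.add_sub_cancel]
          calc c e * s (l + 1) * s l * s (l + 1) = c e * (s (l + 1) * s l * s (l + 1)) := by group
            _ = (c e * s l) * s (l + 1) * s l := by
                rw [hbraid l (by omega) (by omega)]; group
            _ = _ := by rw [hcl e l (by omega) (by omega)]; group
    -- Right multiplication by `s i` permutes the cosets `K c_d`: according to the size of `i + d`,
    -- it passes through `c_d`, appends a letter, cancels the last letter, or passes through as `s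
    -- (i - 1)`.
    have hstep : ∀ i d, 1 ≤ i → i ≤ k + 1 → d ≤ k + 1 → ∀ h ∈ K,
        ∃ h' ∈ K, ∃ d' ≤ k + 1, h * c d * s i = h' * c d' := by
      intro i d hi hik hd h hh
      rcases Nat.lt_or_ge k (i + d) with h1 | h1
      · rcases Nat.lt_or_ge (k + 2) (i + d) with h2 | h2
        · exact ⟨h * s (i - 1), K.mul_mem hh (hsK _ (by omega) (by omega)), d, hd, by
            rw [mul_assoc, hch d i hd h2 hik, mul_assoc]⟩
        · rcases Nat.lt_or_ge (k + 1) (i + d) with h3 | h3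
          · obtain ⟨e, rfl⟩ : ∃ e, d = e + 1 := ⟨d - 1, by omega⟩
            have e1 : k + 1 - e = i := by omega
            exact ⟨h, hh, e, by omega, by
              rw [cS, e1, mul_assoc, mul_assoc, hsq i hi hik, mul_one]⟩
          · have e1 : k + 1 - d = i := by omega
            exact ⟨h, hh, d + 1, by omega, by rw [cS, e1, mul_assoc]⟩
      · exact ⟨h * s i, K.mul_mem hh (hsK _ hi (by omega)), d, hd, by
          rw [mul_assoc, hcl d i hi h1, mul_assoc]⟩
    have hinv : ∀ i, 1 ≤ i → i ≤ k + 1 → (s i)⁻¹ = s i := fun i h h' =>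
      inv_eq_of_mul_eq_one_left (hsq i h h')
    have hdec : ∃ h ∈ K, ∃ d ≤ k + 1, g = h * c d := by
      clear h1
      induction hg using Subgroup.closure_induction_right with
      | one => exact ⟨1, K.one_mem, 0, by omega, by simp [c0]⟩
      | mul_right x _ y hy ihx =>
        obtain ⟨i, hi, hik, rfl⟩ := hy
        obtain ⟨h, hh, d, hd, rfl⟩ := ihx
        exact hstep i d hi hik hd h hh
      | mul_inv_cancel x _ y hy ihx =>
        obtain ⟨i, hi, hik, rfl⟩ := hy
        obtain ⟨h, hh, d, hd, rfl⟩ := ihx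
        rw [hinv i hi hik]
        exact hstep i d hi hik hd h hh
    obtain ⟨h, hh, d, hd, rfl⟩ := hdec
    have hfix : ρ h (k + 2) = k + 2 := by
      have : K ≤ (MulAction.stabilizer (Equiv.Perm ℕ) (k + 2)).comap ρ := by
        rw [hK, Subgroup.closure_le]
        rintro _ ⟨i, hi, hik, rfl⟩
        simp only [Subgroup.coe_comap, Set.mem_preimage, SetLike.mem_coe,
          MulAction.mem_stabilizer_iff, hρ i hi (by omega), Equiv.Perm.smul_def]
        exact Equiv.swap_apply_of_ne_of_ne (by omega) (by omega)
      exact this hh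
    have hcv : ∀ d ≤ k + 1, ρ (c d) (k + 2 - d) = k + 2 := by
      intro d
      induction d with
      | zero => intro _; simp [c0]
      | succ d ihd =>
        intro hd
        rw [cS, map_mul, Equiv.Perm.mul_apply, hρ _ (by omega) (by omega)]
        have e1 : k + 2 - (d + 1) = k + 1 - d := by omega
        have e2 : k + 1 - d + 1 = k + 2 - d := by omega
        rw [e1, Equiv.swap_apply_left, e2, ihd (by omega)]
    -- `c_d` carries `k + 2 - d` to `k + 2`, which `K` fixes; a trivial image therefore forces `d =
    -- 0`.
    have hd0 : d = 0 := by
      have := DFunLike.congr_fun h1 (k + 2 - d)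
      rw [map_mul, Equiv.Perm.mul_apply, hcv d hd, hfix, Equiv.Perm.one_apply] at this
      omega
    subst hd0
    rw [c0, mul_one] at h1 ⊢
    exact ih (fun i h h' => hρ i h (by omega)) (fun i h h' => hsq i h (by omega))
      (fun i j h h' h'' => hcomm i j h h' (by omega)) (fun i h h' => hbraid i h (by omega)) hh h1

/-- Because `σ_i² = A_{i,i+1}`, the quotient by `pureClosure n` satisfies the Coxeter relations, so
it embeds into the permutations. -/
theorem mem_pureClosure_iff {n : ℕ} {g : BraidQuot n} :
    g ∈ pureClosure n ↔ (linkHom n g).perm = 1 := by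
  refine ⟨pureClosure_pure, fun hg => ?_⟩
  rw [← QuotientGroup.eq_one_iff]
  let ρ : BraidQuot n ⧸ pureClosure n →* Equiv.Perm ℕ :=
    QuotientGroup.lift _ (permHom.comp (linkHom n)) fun x hx => pureClosure_pure hx
  refine coxeter_injective (fun i => (sigmaQ n i : BraidQuot n ⧸ pureClosure n)) ρ (n - 1)
    ?_ ?_ ?_ ?_ ?_ hg
  · intro i hi hin
    change (linkHom n (sigmaQ n i)).perm = _
    rw [linkHom_sigmaQ hi hin]
    rfl
  · intro i hi hin
    rw [← QuotientGroup.mk_mul, ← pow_two, ← pureA_self_succ, QuotientGroup.eq_one_iff]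
    exact pureA_mem hi (Nat.lt_succ_self i) (by omega)
  · intro i j _ hij _
    rw [← QuotientGroup.mk_mul, sigmaQ_comm hij, QuotientGroup.mk_mul]
  · intro i hi hin
    rw [← QuotientGroup.mk_mul, ← QuotientGroup.mk_mul, sigmaQ_braid hi hin]
    rfl
  · have h := congrArg (Subgroup.map (QuotientGroup.mk' (pureClosure n))) (closure_sigmaQ n)
    rw [MonoidHom.map_closure,
      Subgroup.map_top_of_surjective _ (QuotientGroup.mk'_surjective _)] at h
    have hsub : (g : BraidQuot n ⧸ pureClosure n) ∈ (⊤ : Subgroup _) := Subgroup.mem_top _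
    rw [← h] at hsub
    refine Subgroup.closure_mono ?_ hsub
    rintro _ ⟨_, ⟨i, hi, hin, rfl⟩, rfl⟩
    exact ⟨i, hi, hin, rfl⟩

/-! ### Crossing numbers determine a class. -/

section Injectivity

variable {n : ℕ}

/-- The elements of `LinkGroup` that only involve the points `1, …, n`, with crossings counted
symmetrically. -/
def supported (n : ℕ) : Subgroup LinkGroup where
  carrier := {g | (∀ x, ¬(1 ≤ x ∧ x ≤ n) → g.perm x = x) ∧ (∀ x y, g.cr x y = g.cr y x) ∧
    (∀ x, g.cr x x = 0) ∧ (∀ x y, ¬(1 ≤ x ∧ x ≤ n) → g.cr x y = 0)}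
  one_mem' := by simp
  mul_mem' := by
    rintro g h ⟨g1, g2, g3, g4⟩ ⟨h1, h2, h3, h4⟩
    refine ⟨fun x hx => ?_, fun x y => ?_, fun x => ?_, fun x y hx => ?_⟩
    · simp [h1 x hx, g1 x hx]
    · simp [h2 x y, g2 (h.perm x)]
    · simp [g3, h3]
    · simp [h4 x y hx, h1 x hx, g4 x _ hx]
  inv_mem' := by
    rintro g ⟨g1, g2, g3, g4⟩
    have g1' : ∀ x, ¬(1 ≤ x ∧ x ≤ n) → g.perm⁻¹ x = x := fun x hx => by
      rw [Equiv.Perm.inv_eq_iff_eq, g1 x hx]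
    refine ⟨g1', fun x y => ?_, fun x => ?_, fun x y hx => ?_⟩
    · rw [inv_cr, inv_cr, g2]
    · simp [g3]
    · simp only [inv_cr, g1' x hx, g4 x _ hx, neg_zero]

theorem linkHom_supported (g : BraidQuot n) : linkHom n g ∈ supported n := by
  have : (⊤ : Subgroup (BraidQuot n)) ≤ (supported n).comap (linkHom n) := by
    rw [← closure_sigmaQ, Subgroup.closure_le]
    rintro _ ⟨i, hi, hin, rfl⟩
    rw [SetLike.mem_coe, Subgroup.mem_comap, linkHom_sigmaQ hi hin]
    refine ⟨fun x hx => ?_, fun x y => ?_, fun x => ?_, fun x y hx => ?_⟩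
    · exact Equiv.swap_apply_of_ne_of_ne (by omega) (by omega)
    · simp only [crossing, pairInd]
      congr 2
      grind
    · simp only [crossing, pairInd]
      rw [if_neg (by omega), mul_zero]
    · simp only [crossing, pairInd]
      rw [if_neg (by omega), mul_zero]
  exact this (Subgroup.mem_top g)

theorem pure_cr_even {g : BraidQuot n} (hg : (linkHom n g).perm = 1) (x y : ℕ) :
    2 ∣ (linkHom n g).cr x y := by
  rw [← mem_pureClosure_iff, pureClosure] at hg
  induction hg using Subgroup.closure_induction with
  | mem g hg =>
    obtain ⟨i, j, hi, hij, hj, rfl⟩ := hg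
    rw [linkHom_pureA hi hij hj]
    exact dvd_mul_right _ _
  | one => simp
  | mul g h hg hh ihg ihh =>
    rw [map_mul, mul_cr, pureClosure_pure hh]
    exact dvd_add ihg ihh
  | inv g hg ih =>
    rw [map_inv, inv_cr, pureClosure_pure hg]
    simpa using ih

instance pureClosure_isMulCommutative (n : ℕ) : IsMulCommutative (pureClosure n) :=
  ⟨⟨fun a b => Subtype.ext (pure_mul_comm (pureClosure_pure a.2) (pureClosure_pure b.2))⟩⟩

/-- The pairs `1 ≤ r < s ≤ n`. -/
abbrev StringPair (n : ℕ) : Type := 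
  {x : ℕ × ℕ // x ∈ (Finset.Icc 1 n ×ˢ Finset.Icc 1 n).filter fun x => x.1 < x.2}

/-- The generator `A_{r,s}` as an element of the commutative group `pureClosure n`. -/
def pureAClosure (n : ℕ) (x : StringPair n) : pureClosure n :=
  ⟨pureA n x.1.1 x.1.2, by
    obtain ⟨⟨r, s⟩, h⟩ := x
    simp only [Finset.mem_filter, Finset.mem_product, Finset.mem_Icc] at h
    exact pureA_mem h.1.1.1 h.2 h.1.2.2⟩

theorem exists_prod_pureA (g : pureClosure n) :
    ∃ k : StringPair n → ℤ, g = ∏ x, pureAClosure n x ^ k x := by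
  obtain ⟨g, hg⟩ := g
  have hg' := hg
  rw [pureClosure] at hg'
  induction hg' using Subgroup.closure_induction with
  | mem g hg' =>
    obtain ⟨i, j, hi, hij, hj, rfl⟩ := hg'
    let p : StringPair n := ⟨(i, j), by simp; omega⟩
    refine ⟨Pi.single p 1, ?_⟩
    rw [Finset.prod_eq_single p]
    · simp [pureAClosure, p]
    · intro b _ hb
      simp [hb]
    · simp
  | one => exact ⟨0, by simp⟩
  | mul g h hg1 hh1 ihg ihh =>
    obtain ⟨k, hk⟩ := ihg hg1
    obtain ⟨l, hl⟩ := ihh hh1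
    refine ⟨k + l, ?_⟩
    simp only [Pi.add_apply, zpow_add, Finset.prod_mul_distrib]
    rw [← hk, ← hl]
    rfl
  | inv g hg1 ih =>
    obtain ⟨k, hk⟩ := ih hg1
    refine ⟨-k, ?_⟩
    simp only [Pi.neg_apply, zpow_neg, Finset.prod_inv_distrib]
    rw [← hk]
    rfl

/-- The crossings between two strings, as a homomorphism on the pure classes. -/
def crHom (n x y : ℕ) : pureClosure n →* Multiplicative ℤ where
  toFun g := Multiplicative.ofAdd ((linkHom n g).cr x y)
  map_one' := by simp
  map_mul' g h := by
    rw [Subgroup.coe_mul, map_mul, mul_cr, pureClosure_pure h.2]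
    rfl

/-- An element of the kernel is pure, hence a product of powers of the `A_{r,s}`; its crossing
number at `(r, s)` is twice the exponent of `A_{r,s}`, so all exponents vanish. -/
theorem linkHom_injective (n : ℕ) : Function.Injective (linkHom n) := by
  rw [injective_iff_map_eq_one]
  intro g hg
  have hp : g ∈ pureClosure n := mem_pureClosure_iff.2 (by rw [hg]; rfl)
  obtain ⟨k, hk⟩ := exists_prod_pureA ⟨g, hp⟩
  have hzero : ∀ x, k x = 0 := by
    intro x
    have h := congrArg (crHom n x.1.1 x.1.2) hk
    rw [map_prod, Finset.prod_eq_single x] at h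
    · obtain ⟨⟨r, s⟩, hx⟩ := x
      have hx' := hx
      simp only [Finset.mem_filter, Finset.mem_product, Finset.mem_Icc] at hx'
      have h := congrArg Multiplicative.toAdd h
      simp only [crHom, hg, map_zpow, MonoidHom.coe_mk, OneHom.coe_mk, toAdd_zpow, toAdd_ofAdd,
        pureAClosure, one_cr, linkHom_pureA hx'.1.1.1 hx'.2 hx'.1.2.2] at h
      simpa [pairInd] using h.symm
    · intro z _ hz
      rw [map_zpow]
      obtain ⟨⟨r, s⟩, hx⟩ := x
      obtain ⟨⟨a, b⟩, hz'⟩ := z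
      have hx' := hx
      have hz'' := hz'
      simp only [Finset.mem_filter, Finset.mem_product, Finset.mem_Icc] at hx' hz''
      have : crHom n r s (pureAClosure n ⟨(a, b), hz'⟩) = 1 := by
        simp only [crHom, MonoidHom.coe_mk, OneHom.coe_mk,
          pureAClosure, linkHom_pureA hz''.1.1.1 hz''.2 hz''.1.2.2]
        rw [pairInd, if_neg]
        · rfl
        · rintro (⟨rfl, rfl⟩ | ⟨rfl, rfl⟩)
          · exact hz rfl
          · omega
      simp only [this, one_zpow]
    · simp
  simp only [hzero, zpow_zero, Finset.prod_const_one] at hk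
  exact congrArg Subtype.val hk

end Injectivity

/-! ### Crossing numbers of a block rotation, and their removal by a coboundary. -/

namespace LinkGroup

/-- A strand passing from position `b + 1 - k` to position `b + 1`, with crossings of sign `ε`. -/
theorem prod_crossing {ε : ℤ} {b k : ℕ} (hk : k ≤ b) :
    (∀ z, ((List.range k).map fun s => crossing ε (b - s)).prod.perm z =
      if z = b + 1 - k then b + 1 else if b + 1 - k < z ∧ z ≤ b + 1 then z - 1 else z) ∧
    ∀ x y, ((List.range k).map fun s => crossing ε (b - s)).prod.cr x y =
      if (x = b + 1 - k ∧ b + 1 - k < y ∧ y ≤ b + 1) ∨ (y = b + 1 - k ∧ b + 1 - k < x ∧ x ≤ b + 1)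
      then ε else 0 := by
  induction k with
  | zero =>
    refine ⟨fun z => ?_, fun x y => ?_⟩
    · simp only [List.range_zero, List.map_nil, List.prod_nil, one_perm, Equiv.Perm.one_apply]
      split_ifs <;> omega
    · simp only [List.range_zero, List.map_nil, List.prod_nil, one_cr]
      rw [if_neg (by omega)]
  | succ k ih =>
    obtain ⟨ih1, ih2⟩ := ih (by omega)
    obtain ⟨c, rfl⟩ : ∃ c, b = c + k := ⟨b - k, by omega⟩
    have e1 : c + k + 1 - (k + 1) = c := by omega
    have e2 : c + k + 1 - k = c + 1 := by omega
    have e3 : c + k - k = c := by omega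
    rw [e2] at ih1 ih2
    simp only [List.range_succ, List.map_append, List.map_cons, List.map_nil, List.prod_append,
      List.prod_singleton, mul_perm, mul_cr, Equiv.Perm.mul_apply, e1, e3, ih1, ih2]
    clear e1 e2 e3 ih1 ih2 ih
    refine ⟨fun z => ?_, fun x y => ?_⟩
    · simp only [crossing, Equiv.swap_apply_def]
      rcases eq_or_ne z c with rfl | h1
      · simp
      · rcases eq_or_ne z (c + 1) with rfl | h2
        · simp
        · simp only [h1, h2, if_false]
          split_ifs <;> omega
    · simp only [crossing, Equiv.swap_apply_def, pairInd, mul_ite, mul_one, mul_zero]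
      rcases eq_or_ne x c with rfl | h1
      · rcases eq_or_ne y x with rfl | h3
        · simp
        · rcases eq_or_ne y (x + 1) with rfl | h4
          · simp
          · simp only [h3, h4, ↓reduceIte, true_and, and_true, false_and, and_false,
                or_false, false_or]
            split_ifs <;> omega
      · rcases eq_or_ne x (c + 1) with rfl | h2
        · rcases eq_or_ne y c with rfl | h3
          · simp
          · rcases eq_or_ne y (c + 1) with rfl | h4
            · simp
            · simp only [h1, h3, h4, ↓reduceIte, true_and, and_true, false_and, and_false,
                or_false, false_or]
              split_ifs <;> omega
        · rcases eq_or_ne y c with rfl | h3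
          · simp only [h1, h2, ↓reduceIte, true_and, and_true, false_and, and_false,
                or_false, false_or]
            split_ifs <;> omega
          · rcases eq_or_ne y (c + 1) with rfl | h4
            · simp only [h1, h2, h3, ↓reduceIte, true_and, and_true, false_and, and_false,
                or_false, false_or]
              split_ifs <;> omega
            · simp only [h1, h2, h3, h4, ↓reduceIte, true_and, and_true, false_and, and_false,
                or_false, false_or]
              rfl

/-- The rotation of the positions `a + 1, …, a + m` that lowers each but the first by one. -/
def rotFun (a m z : ℕ) : ℕ :=
  if z = a + 1 then a + m else if a + 1 < z ∧ z ≤ a + m then z - 1 else z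

end LinkGroup

theorem linkHom_deltaBlock_eq {n a c : ℕ} (hn : a + (2 * c + 1) ≤ n) :
    linkHom n (deltaBlock n a (2 * c + 1)) =
      ((List.range c).map fun s => crossing 1 (a + 2 * c - s)).prod *
      ((List.range c).map fun s => crossing (-1) (a + c - s)).prod := by
  have e1 : (2 * c + 1 - 1) / 2 = c := by omega
  have e2 : a + (2 * c + 1) - 1 = a + 2 * c := by omega
  rw [deltaBlock, e1, e2, map_mul, map_list_prod, map_list_prod, List.map_map, List.map_map]
  congr 2 <;> apply List.map_congr_left <;> intro s hs <;> rw [List.mem_range] at hs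
  · exact linkHom_sigmaQ (by omega) (by omega)
  · rw [Function.comp_apply, map_inv, linkHom_sigmaQ (by omega) (by omega), crossing_inv]

theorem linkHom_deltaBlock_perm {n a c : ℕ} (hn : a + (2 * c + 1) ≤ n) (z : ℕ) :
    (linkHom n (deltaBlock n a (2 * c + 1))).perm z = rotFun a (2 * c + 1) z := by
  rw [linkHom_deltaBlock_eq hn, mul_perm, Equiv.Perm.mul_apply,
    (prod_crossing (by omega)).1, (prod_crossing (by omega)).1, rotFun]
  have e1 : a + 2 * c + 1 - c = a + c + 1 := by omega
  have e2 : a + c + 1 - c = a + 1 := by omega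
  rw [e1, e2]
  split_ifs <;> omega

/-- The right factor acts first: the strand at `a + 1` passes its first `c` neighbours with sign
`-1`, then the remaining `c` with sign `+1`. No other strands cross. -/
theorem linkHom_deltaBlock_cr {n a c : ℕ} (hn : a + (2 * c + 1) ≤ n) (x y : ℕ) :
    (linkHom n (deltaBlock n a (2 * c + 1))).cr x y =
      if (x = a + 1 ∧ a + 1 < y ∧ y ≤ a + c + 1) ∨ (y = a + 1 ∧ a + 1 < x ∧ x ≤ a + c + 1) then -1
      else if (x = a + 1 ∧ a + c + 1 < y ∧ y ≤ a + 2 * c + 1) ∨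
        (y = a + 1 ∧ a + c + 1 < x ∧ x ≤ a + 2 * c + 1) then 1 else 0 := by
  rw [linkHom_deltaBlock_eq hn, mul_cr,
    (prod_crossing (by omega)).1, (prod_crossing (by omega)).1, (prod_crossing (by omega)).2,
    (prod_crossing (by omega)).2]
  have e1 : a + 2 * c + 1 - c = a + c + 1 := by omega
  have e2 : a + c + 1 - c = a + 1 := by omega
  rw [e1, e2]
  rcases eq_or_ne x (a + 1) with rfl | h1
  · rcases eq_or_ne y (a + 1) with rfl | h2
    · simp
    · simp only [h2, ↓reduceIte, true_and, and_true, false_and, and_false,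
                or_false, false_or]
      split_ifs <;> omega
  · rcases eq_or_ne y (a + 1) with rfl | h2
    · simp only [h1, ↓reduceIte, true_and, and_true, false_and, and_false,
                or_false, false_or]
      split_ifs <;> omega
    · simp only [h1, h2, ↓reduceIte, true_and, and_true, false_and, and_false,
                or_false, false_or]
      split_ifs <;> omega

/-- Conjugation by crossing numbers without permutation. -/
def twist (f : ℕ → ℕ → ℤ) : LinkGroup →* LinkGroup :=
  (MulAut.conj (⟨1, fun x y => -f x y⟩ : LinkGroup)).toMonoidHom

@[simp] theorem twist_perm (f : ℕ → ℕ → ℤ) (g : LinkGroup) : (twist f g).perm = g.perm := by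
  simp [twist, MulAut.conj_apply]

theorem twist_cr (f : ℕ → ℕ → ℤ) (g : LinkGroup) (x y : ℕ) :
    (twist f g).cr x y = g.cr x y - f (g.perm x) (g.perm y) + f x y := by
  simp [twist, MulAut.conj_apply]
  ring

/-- With `f` the indicator of distance at most `c`, only pairs `(a + 1, y)` change distance. For `y
≤ a + c + 1` the value of `f` drops from 1 to 0, beyond that it rises from 0 to 1, which matches the
signs of the crossings. -/
theorem twist_deltaBlock_cr {n a c : ℕ} (hn : a + (2 * c + 1) ≤ n) (f : ℕ → ℕ → ℤ)
    (hin : ∀ x y, a < x → x ≤ a + (2 * c + 1) → a < y → y ≤ a + (2 * c + 1) →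
      f x y = if x ≤ y + c ∧ y ≤ x + c then 1 else 0)
    (hout : ∀ x y, a < x → x ≤ a + (2 * c + 1) → ¬(a < y ∧ y ≤ a + (2 * c + 1)) →
      f x y = 0 ∧ f y x = 0) (x y : ℕ) :
    (twist f (linkHom n (deltaBlock n a (2 * c + 1)))).cr x y = 0 := by
  rw [twist_cr, linkHom_deltaBlock_cr hn, linkHom_deltaBlock_perm hn, linkHom_deltaBlock_perm hn]
  have hmem : ∀ z, a < z ∧ z ≤ a + (2 * c + 1) →
      a < rotFun a (2 * c + 1) z ∧ rotFun a (2 * c + 1) z ≤ a + (2 * c + 1) := by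
    intro z hz
    rw [rotFun]
    split_ifs <;> omega
  have hfix : ∀ z, ¬(a < z ∧ z ≤ a + (2 * c + 1)) → rotFun a (2 * c + 1) z = z := by
    intro z hz
    rw [rotFun, if_neg (by omega), if_neg (by omega)]
  by_cases hx : a < x ∧ x ≤ a + (2 * c + 1)
  · by_cases hy : a < y ∧ y ≤ a + (2 * c + 1)
    · rw [hin _ _ (hmem x hx).1 (hmem x hx).2 (hmem y hy).1 (hmem y hy).2,
        hin _ _ hx.1 hx.2 hy.1 hy.2]
      simp only [rotFun]
      rcases eq_or_ne x (a + 1) with rfl | h1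
      · rcases eq_or_ne y (a + 1) with rfl | h2
        · simp
        · simp only [h2, ↓reduceIte, true_and, and_true, false_and, and_false,
                or_false, false_or]
          split_ifs <;> omega
      · rcases eq_or_ne y (a + 1) with rfl | h2
        · simp only [h1, ↓reduceIte, true_and, and_true, false_and, and_false,
                or_false, false_or]
          split_ifs <;> omega
        · simp only [h1, h2, ↓reduceIte, true_and, and_true, false_and, and_false,
                or_false, false_or]
          split_ifs <;> omega
    · rw [hfix y hy, (hout _ _ (hmem x hx).1 (hmem x hx).2 hy).1, (hout _ _ hx.1 hx.2 hy).1,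
        if_neg (by omega), if_neg (by omega)]
      simp
  · by_cases hy : a < y ∧ y ≤ a + (2 * c + 1)
    · rw [hfix x hx, (hout _ _ (hmem y hy).1 (hmem y hy).2 hx).2, (hout _ _ hy.1 hy.2 hx).2,
        if_neg (by omega), if_neg (by omega)]
      simp
    · rw [hfix x hx, hfix y hy, if_neg (by omega), if_neg (by omega)]
      simp

/-! ### Blocks, cyclic coordinates and normalized crossing numbers. -/

section BlockGeometry

variable {t : ℕ} (m : Fin t → ℕ)

/-- The hypotheses on the block sizes that are used below. -/
structure OddCoprime : Prop where
  odd : ∀ j, Odd (m j)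
  three_le : ∀ j, 3 ≤ m j
  coprime : Pairwise (Function.onFun Nat.Coprime m)

/-- The point `x` belongs to the block `j`. -/
def InBlock (j : Fin t) (x : ℕ) : Prop := blockStart m j < x ∧ x ≤ blockStart m j + m j

theorem sum_Iic_eq (j : Fin t) : ∑ i ∈ Finset.Iic j, m i = blockStart m j + m j := by
  rw [← Finset.Iio_insert, Finset.sum_insert (by simp), blockStart, add_comm]

theorem blockStart_add_le {j l : Fin t} (h : j < l) :
    blockStart m j + m j ≤ blockStart m l := by
  rw [← sum_Iic_eq, blockStart]
  refine Finset.sum_le_sum_of_subset fun i hi => ?_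
  rw [Finset.mem_Iic] at hi
  exact Finset.mem_Iio.2 (hi.trans_lt h)

theorem blockStart_add_le_numStrings (j : Fin t) : blockStart m j + m j ≤ numStrings m := by
  rw [← sum_Iic_eq, numStrings]
  exact Finset.sum_le_sum_of_subset (Finset.subset_univ _)

variable {m}

theorem InBlock.unique {j l : Fin t} {x : ℕ} (hj : InBlock m j x) (hl : InBlock m l x) : j = l := by
  unfold InBlock at hj hl
  rcases lt_trichotomy j l with h | h | h
  · have := blockStart_add_le m h
    omega
  · exact h
  · have := blockStart_add_le m h
    omega

theorem InBlock.mem {j : Fin t} {x : ℕ} (hj : InBlock m j x) : 1 ≤ x ∧ x ≤ numStrings m := by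
  have := blockStart_add_le_numStrings m j
  unfold InBlock at hj
  omega

theorem exists_inBlock {x : ℕ} (hx : 1 ≤ x) (hxn : x ≤ numStrings m) : ∃ j, InBlock m j x := by
  have key : ∀ k ≤ t, x ≤ ∑ i ∈ Finset.univ.filter (fun i : Fin t => (i : ℕ) < k), m i → ∃ j, InBlock m j x := by
    intro k
    induction k with
    | zero =>
      intro _ h
      simp at h
      omega
    | succ k ih =>
      intro hk h
      by_cases h' : x ≤ ∑ i ∈ Finset.univ.filter (fun i : Fin t => (i : ℕ) < k), m i
      · exact ih (by omega) h'
      · refine ⟨⟨k, hk⟩, ?_⟩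
        have e1 : (Finset.univ.filter fun i : Fin t => (i : ℕ) < k + 1) =
            Finset.Iic (⟨k, hk⟩ : Fin t) := by
          ext i; simp [Fin.le_def]
        have e2 : (Finset.univ.filter fun i : Fin t => (i : ℕ) < k) =
            Finset.Iio (⟨k, hk⟩ : Fin t) := by
          ext i; simp [Fin.lt_def]
        rw [e1, sum_Iic_eq] at h
        rw [e2] at h'
        exact ⟨not_le.1 h', h⟩
  refine key t le_rfl ?_
  rw [numStrings] at hxn
  simpa using hxn

variable (m)

/-- The point of the block `j` with the cyclic coordinate `u`. -/
def pt (j : Fin t) (u : ℤ) : ℕ := blockStart m j + 1 + (u % m j).toNat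

variable {m}

theorem dvd_emod_sub (u : ℤ) (k : ℕ) : (k : ℤ) ∣ u % k - u :=
  Int.ModEq.dvd (Int.mod_modEq u k).symm

theorem OddCoprime.pt_mem (hm : OddCoprime m) (j : Fin t) (u : ℤ) : InBlock m j (pt m j u) := by
  have h3 := hm.three_le j
  have h1 := Int.emod_nonneg u (b := m j) (by omega)
  have h2 := Int.emod_lt_of_pos u (b := m j) (by omega)
  unfold InBlock pt
  omega

theorem OddCoprime.pt_dvd (hm : OddCoprime m) (j : Fin t) (u : ℤ) :
    (m j : ℤ) ∣ (pt m j u : ℤ) - (blockStart m j + 1) - u := by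
  have h3 := hm.three_le j
  have h1 := Int.emod_nonneg u (b := m j) (by omega)
  have : (pt m j u : ℤ) - (blockStart m j + 1) - u = u % m j - u := by
    unfold pt
    push_cast
    rw [Int.toNat_of_nonneg h1]
    ring
  rw [this]
  exact dvd_emod_sub u (m j)

theorem eq_pt {j : Fin t} {x : ℕ} {u : ℤ} (hx : InBlock m j x)
    (h : (m j : ℤ) ∣ (x : ℤ) - (blockStart m j + 1) - u) : x = pt m j u := by
  unfold InBlock at hx
  have : u % m j = (x : ℤ) - (blockStart m j + 1) := by
    have h1 : u % m j = ((x : ℤ) - (blockStart m j + 1)) % m j := (Int.modEq_iff_dvd.2 h)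
    rw [h1]
    exact Int.emod_eq_of_lt (by omega) (by omega)
  unfold pt
  omega

theorem exists_pt {j : Fin t} {x : ℕ} (hx : InBlock m j x) : ∃ u, x = pt m j u :=
  ⟨_, eq_pt hx (u := (x : ℤ) - (blockStart m j + 1)) (by simp)⟩

theorem pt_eq_of_lt {j : Fin t} {d : ℕ} (hd : d < m j) : pt m j d = blockStart m j + 1 + d := by
  rw [pt, Int.emod_eq_of_lt (by omega) (by omega), Int.toNat_natCast]

theorem OddCoprime.pt_eq_pt (hm : OddCoprime m) {j : Fin t} {u v : ℤ} :
    pt m j u = pt m j v ↔ (m j : ℤ) ∣ u - v := by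
  constructor
  · intro h
    have h1 := hm.pt_dvd j u
    have h2 := hm.pt_dvd j v
    rw [h] at h1
    have := dvd_sub h2 h1
    ring_nf at this ⊢
    simpa [add_comm, sub_eq_add_neg] using this
  · intro h
    refine eq_pt (hm.pt_mem j u) ?_
    have := dvd_add (hm.pt_dvd j u) h
    ring_nf at this ⊢
    exact this

theorem OddCoprime.pt_block (hm : OddCoprime m) {j l : Fin t} {u v : ℤ} (h : pt m j u = pt m l v) :
    j = l :=
  InBlock.unique (hm.pt_mem j u) (h ▸ hm.pt_mem l v)

theorem OddCoprime.rotFun_pt (hm : OddCoprime m) (j : Fin t) (u : ℤ) :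
    rotFun (blockStart m j) (m j) (pt m j u) = pt m j (u - 1) := by
  have h1 := hm.pt_mem j u
  have h2 := hm.pt_dvd j u
  have h3 := hm.three_le j
  unfold InBlock at h1
  have hin : InBlock m j (rotFun (blockStart m j) (m j) (pt m j u)) := by
    unfold rotFun InBlock
    split_ifs <;> omega
  refine eq_pt hin ?_
  rw [rotFun]
  split_ifs with h h'
  · rw [h] at h2
    have := dvd_add h2 (dvd_refl (m j : ℤ))
    push_cast at this ⊢
    ring_nf at this ⊢
    exact this
  · have e : (pt m j u - 1 : ℕ) = (pt m j u : ℤ) - 1 := by omega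
    rw [e]
    ring_nf at h2 ⊢
    exact h2
  · omega

theorem rotFun_of_not_inBlock {j : Fin t} {x : ℕ} (h : ¬InBlock m j x) (h3 : 1 ≤ m j) :
    rotFun (blockStart m j) (m j) x = x := by
  unfold InBlock at h
  rw [rotFun, if_neg (by omega), if_neg (by omega)]

/-- The Chinese remainder theorem: a power of the simultaneous rotation realizes any prescribed
rotations of the blocks. -/
theorem OddCoprime.exists_nat_dvd (hm : OddCoprime m) (w : Fin t → ℤ) :
    ∃ k : ℕ, ∀ j, (m j : ℤ) ∣ k - w j := by
  obtain ⟨k, hk⟩ := Nat.chineseRemainderOfFinset (fun j => (w j % m j).toNat) m Finset.univ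
    (fun j _ => by have := hm.three_le j; omega) (hm.coprime.set_pairwise _)
  refine ⟨k, fun j => ?_⟩
  have h := (Nat.modEq_iff_dvd.1 (hk j (Finset.mem_univ j)).symm)
  have h3 := hm.three_le j
  rw [Int.toNat_of_nonneg (Int.emod_nonneg _ (by omega))] at h
  have := dvd_add h (dvd_emod_sub (w j) (m j))
  simpa using this

variable (m)

open Classical in
/-- The cochain whose coboundary is the crossing number of the block rotations. -/
noncomputable def blockTwist (x y : ℕ) : ℤ :=
  if ∃ j, InBlock m j x ∧ InBlock m j y ∧ x ≤ y + (m j - 1) / 2 ∧ y ≤ x + (m j - 1) / 2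
  then 1 else 0

/-- Crossing numbers, normalized in such a way that the block rotations have none. -/
noncomputable def blockHom : BraidQuot (numStrings m) →* LinkGroup :=
  (twist (blockTwist m)).comp (linkHom (numStrings m))

variable {m}

@[simp] theorem blockHom_perm (g : BraidQuot (numStrings m)) :
    (blockHom m g).perm = (linkHom _ g).perm := by simp [blockHom]

/-- For a trivial permutation the two coboundary terms cancel, so normalization does not affect pure
classes. -/
theorem blockHom_cr {g : BraidQuot (numStrings m)} (hg : (blockHom m g).perm = 1) (x y : ℕ) :
    (blockHom m g).cr x y = (linkHom _ g).cr x y := by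
  rw [blockHom_perm] at hg
  rw [blockHom, MonoidHom.comp_apply, twist_cr, hg]
  simp

theorem blockHom_injective : Function.Injective (blockHom m) :=
  (MulAut.conj _).injective.comp (linkHom_injective _)

theorem blockHom_pureA {r s : ℕ} (hr : 1 ≤ r) (hrs : r < s) (hs : s ≤ numStrings m) :
    blockHom m (pureA _ r s) = ⟨1, fun x y => 2 * pairInd r s x y⟩ := by
  have h := pureA_pure hr hrs hs
  have h' : (blockHom m (pureA _ r s)).perm = 1 := by rw [blockHom_perm, h]
  ext x y
  · rw [h']
  · rw [blockHom_cr h', linkHom_pureA hr hrs hs]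

variable (m) in
/-- The class of the rotation of the block `j`. -/
abbrev blockDelta (j : Fin t) : BraidQuot (numStrings m) :=
  deltaBlock (numStrings m) (blockStart m j) (m j)

theorem OddCoprime.blockDelta_perm (hm : OddCoprime m) (j : Fin t) (x : ℕ) :
    (blockHom m (blockDelta m j)).perm x = rotFun (blockStart m j) (m j) x := by
  have hn := blockStart_add_le_numStrings m j
  obtain ⟨c, hc⟩ := hm.odd j
  rw [blockHom_perm, blockDelta]
  rw [hc] at hn ⊢
  exact linkHom_deltaBlock_perm hn x

theorem OddCoprime.blockDelta_cr (hm : OddCoprime m) (j : Fin t) (x y : ℕ) :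
    (blockHom m (blockDelta m j)).cr x y = 0 := by
  have hn := blockStart_add_le_numStrings m j
  obtain ⟨c, hc⟩ := hm.odd j
  have hc2 : (m j - 1) / 2 = c := by omega
  rw [blockHom, MonoidHom.comp_apply, blockDelta]
  have hin : ∀ x y, blockStart m j < x → x ≤ blockStart m j + (2 * c + 1) →
      blockStart m j < y → y ≤ blockStart m j + (2 * c + 1) →
      blockTwist m x y = if x ≤ y + c ∧ y ≤ x + c then 1 else 0 := by
    intro x y h1 h2 h3 h4
    rw [← hc] at h2 h4
    rw [blockTwist]
    congr 1
    rw [eq_iff_iff]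
    constructor
    · rintro ⟨l, hx, hy, h⟩
      obtain rfl := InBlock.unique hx ⟨h1, h2⟩
      rwa [hc2] at h
    · intro h
      exact ⟨j, ⟨h1, h2⟩, ⟨h3, h4⟩, by rwa [hc2]⟩
  have hout : ∀ x y, blockStart m j < x → x ≤ blockStart m j + (2 * c + 1) →
      ¬(blockStart m j < y ∧ y ≤ blockStart m j + (2 * c + 1)) →
      blockTwist m x y = 0 ∧ blockTwist m y x = 0 := by
    intro x y h1 h2 h3
    rw [← hc] at h2 h3
    constructor <;> rw [blockTwist, if_neg]
    · rintro ⟨l, hx, hy, -⟩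
      obtain rfl := InBlock.unique hx ⟨h1, h2⟩
      exact h3 hy
    · rintro ⟨l, hy, hx, -⟩
      obtain rfl := InBlock.unique hx ⟨h1, h2⟩
      exact h3 hy
  have := twist_deltaBlock_cr (n := numStrings m) (hc ▸ hn) (blockTwist m) hin hout x y
  rwa [← hc] at this

theorem OddCoprime.blockDelta_perm_pt (hm : OddCoprime m) (j l : Fin t) (u : ℤ) :
    (blockHom m (blockDelta m j)).perm (pt m l u) = pt m l (if l = j then u - 1 else u) := by
  rw [hm.blockDelta_perm]
  split_ifs with h
  · rw [h, hm.rotFun_pt]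
  · exact rotFun_of_not_inBlock (fun h' => h (InBlock.unique (hm.pt_mem l u) h'))
      (by have := hm.three_le j; omega)

theorem OddCoprime.blockGen_perm (hm : OddCoprime m) (j : Fin t) :
    (blockHom m (blockGen m j)).perm = (blockHom m (blockDelta m j)).perm := by
  have h1 := blockStart_add_le_numStrings m j
  have h2 := hm.three_le j
  rw [blockGen, map_mul, mul_perm, blockHom_pureA (by omega) (by omega) (by omega)]
  exact one_mul _

theorem OddCoprime.blockGen_cr (hm : OddCoprime m) (j : Fin t) (x y : ℕ) :
    (blockHom m (blockGen m j)).cr x y =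
      2 * pairInd (pt m j 0) (pt m j 1) ((blockHom m (blockDelta m j)).perm x)
        ((blockHom m (blockDelta m j)).perm y) := by
  have h1 := blockStart_add_le_numStrings m j
  have h2 := hm.three_le j
  have e0 : pt m j 0 = blockStart m j + 1 := pt_eq_of_lt (d := 0) (by omega)
  have e1 : pt m j 1 = blockStart m j + 2 := pt_eq_of_lt (d := 1) (by omega)
  rw [blockGen, map_mul, mul_cr, hm.blockDelta_cr, blockHom_pureA (by omega) (by omega) (by omega),
    e0, e1, add_zero]

theorem OddCoprime.deltaAll_perm_pt (hm : OddCoprime m) (j : Fin t) (u : ℤ) :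
    (blockHom m (deltaAll m)).perm (pt m j u) = pt m j (u - 1) := by
  -- Without repetitions in the list, each block is rotated at most once.
  have key : ∀ l : List (Fin t), l.Nodup →
      (blockHom m (l.map (blockDelta m)).prod).perm (pt m j u) =
        pt m j (if j ∈ l then u - 1 else u) := by
    intro l
    induction l with
    | nil => simp
    | cons i l ih =>
      intro hl
      rw [List.nodup_cons] at hl
      rw [List.map_cons, List.prod_cons, map_mul, mul_perm, Equiv.Perm.mul_apply, ih hl.2,
        hm.blockDelta_perm_pt]
      by_cases h : j = i
      · subst h
        simp [hl.1]
      · simp [h]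
  rw [deltaAll, List.ofFn_eq_map, key _ (List.nodup_finRange t)]
  simp

theorem OddCoprime.deltaAll_pow_perm_pt (hm : OddCoprime m) (k : ℕ) (j : Fin t) (u : ℤ) :
    ((blockHom m (deltaAll m)).perm ^ k) (pt m j u) = pt m j (u - k) := by
  induction k with
  | zero => simp
  | succ k ih =>
    rw [pow_succ', Equiv.Perm.mul_apply, ih, hm.deltaAll_perm_pt]
    push_cast
    ring_nf

theorem perm_eq_of_pt {g h : BraidQuot (numStrings m)}
    (H : ∀ j u, (blockHom m g).perm (pt m j u) = (blockHom m h).perm (pt m j u)) :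
    (blockHom m g).perm = (blockHom m h).perm := by
  ext x
  by_cases hx : 1 ≤ x ∧ x ≤ numStrings m
  · obtain ⟨j, hj⟩ := exists_inBlock hx.1 hx.2
    obtain ⟨u, rfl⟩ := exists_pt hj
    exact H j u
  · rw [blockHom_perm, blockHom_perm, (linkHom_supported g).1 x hx, (linkHom_supported h).1 x hx]

theorem OddCoprime.blockDelta_perm_eq_pow (hm : OddCoprime m) (j : Fin t) :
    ∃ e : ℕ, (blockHom m (blockDelta m j)).perm = (blockHom m (deltaAll m)).perm ^ e := by
  -- The exponent is 1 modulo `m j` and 0 modulo the other block sizes.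
  obtain ⟨e, he⟩ := hm.exists_nat_dvd (Pi.single j 1)
  refine ⟨e, ?_⟩
  rw [← pow_perm, ← map_pow]
  refine perm_eq_of_pt fun l u => ?_
  rw [map_pow, pow_perm, hm.deltaAll_pow_perm_pt, hm.blockDelta_perm_pt, hm.pt_eq_pt]
  have := he l
  split_ifs with h
  · subst h
    rw [Pi.single_eq_same] at this
    convert this using 1
    ring
  · rw [Pi.single_eq_of_ne h] at this
    convert this using 1
    ring

end BlockGeometry

/-! ### Powers, conjugates and commutation in `LinkGroup`. -/

namespace LinkGroup

theorem conj_cr {g : LinkGroup} (hg : g.perm = 1) (h : LinkGroup) (x y : ℕ) :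
    (h * g * h⁻¹).cr x y = g.cr (h.perm⁻¹ x) (h.perm⁻¹ y) := by
  simp [hg]

theorem conj_perm {g : LinkGroup} (hg : g.perm = 1) (h : LinkGroup) : (h * g * h⁻¹).perm = 1 := by
  simp [hg]

theorem pow_cr (g : LinkGroup) (k x y : ℕ) :
    (g ^ k).cr x y = ∑ i ∈ Finset.range k, g.cr ((g.perm ^ i) x) ((g.perm ^ i) y) := by
  induction k with
  | zero => simp
  | succ k ih =>
    rw [pow_succ', mul_cr, ih, pow_perm, Finset.sum_range_succ, add_comm]

theorem list_prod_perm_cr (f : ℕ → LinkGroup) (hf : ∀ k, (f k).perm = 1) (M : ℕ) :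
    ((List.range M).map f).prod.perm = 1 ∧
      ∀ x y, ((List.range M).map f).prod.cr x y = ∑ k ∈ Finset.range M, (f k).cr x y := by
  induction M with
  | zero => simp
  | succ M ih =>
    simp only [List.range_succ, List.map_append, List.map_cons, List.map_nil, List.prod_append,
      List.prod_singleton, mul_perm, mul_cr, ih.1, ih.2, hf, one_mul, true_and]
    intro x y
    rw [Finset.sum_range_succ]
    rfl

/-- The permutations that leave a function of two points unchanged. -/
def invariance (c : ℕ → ℕ → ℤ) : Subgroup (Equiv.Perm ℕ) where
  carrier := {π | ∀ x y, c (π x) (π y) = c x y}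
  one_mem' := fun _ _ => rfl
  mul_mem' := fun {π ρ} hπ hρ x y => by
    rw [Equiv.Perm.mul_apply, Equiv.Perm.mul_apply, hπ, hρ]
  inv_mem' := fun {π} hπ x y => by
    rw [← hπ]
    simp

/-- The crossings of `h` occur on both sides and cancel; what remains compares `g.cr` before and
after moving the points by `h.perm`. -/
theorem mul_comm_iff {g : LinkGroup} (hg : g.perm = 1) (h : LinkGroup) :
    g * h = h * g ↔ h.perm ∈ invariance g.cr := by
  constructor
  · intro H x y
    have := congrFun (congrFun (congrArg cr H) x) y
    rw [mul_cr, mul_cr, hg] at this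
    simp only [Equiv.Perm.one_apply] at this
    linarith
  · intro H
    ext x
    · simp [hg]
    · rw [mul_cr, mul_cr, hg, H]
      simp [add_comm]

end LinkGroup

/-! ### Orbits of unordered pairs of points under `δ`. -/

section Orbits

variable {t : ℕ} {m : Fin t → ℕ}

/-- The two blocks and the cyclic distance that determine an orbit of pairs of points. -/
def orbitCode (m : Fin t → ℕ) : OrbitIndex m → Fin t × Fin t × ℕ
  | Sum.inl j => (j, j, 1)
  | Sum.inr (Sum.inl x) => (x.1, x.1, x.2 + 1)
  | Sum.inr (Sum.inr x) => (x.1.1, x.1.2, 0)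

/-- The factor with which the pure generators occur in the generators of `GammaQ`. -/
def orbitWeight (m : Fin t → ℕ) : OrbitIndex m → ℕ
  | Sum.inl _ => 1
  | Sum.inr _ => holonomyOrder m

/-- The number of pairs in an orbit. -/
def orbitLen (m : Fin t → ℕ) : OrbitIndex m → ℕ
  | Sum.inl j => m j
  | Sum.inr (Sum.inl x) => m x.1
  | Sum.inr (Sum.inr x) => m x.1.1 * m x.1.2

/-- The first point of the pair representing an orbit. -/
def orbitFst (m : Fin t → ℕ) (i : OrbitIndex m) : ℕ := pt m (orbitCode m i).1 0

/-- The second point of the pair representing an orbit. -/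
def orbitSnd (m : Fin t → ℕ) (i : OrbitIndex m) : ℕ :=
  pt m (orbitCode m i).2.1 (orbitCode m i).2.2

/-- The permutation of the points under the class `δ`. -/
noncomputable def totalPerm (m : Fin t → ℕ) : Equiv.Perm ℕ := (blockHom m (deltaAll m)).perm

theorem orbitCode_injective (m : Fin t → ℕ) : Function.Injective (orbitCode m) := by
  rintro (j | ⟨j, h, hh⟩ | ⟨⟨j, l⟩, hjl⟩) (j' | ⟨j', h', hh'⟩ | ⟨⟨j', l'⟩, hjl'⟩) H <;>
    simp only [orbitCode, Prod.mk.injEq] at H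
  · rw [H.1]
  · rw [Finset.mem_Icc] at hh'; omega
  · omega
  · rw [Finset.mem_Icc] at hh; omega
  · obtain ⟨rfl, -, H⟩ := H
    obtain rfl : h = h' := by omega
    rfl
  · omega
  · omega
  · omega
  · obtain ⟨rfl, rfl, -⟩ := H
    rfl

theorem OddCoprime.orbitCode_cases (hm : OddCoprime m) (i : OrbitIndex m) :
    ((orbitCode m i).1 = (orbitCode m i).2.1 ∧ 1 ≤ (orbitCode m i).2.2 ∧
      2 * (orbitCode m i).2.2 + 1 ≤ m (orbitCode m i).1 ∧ orbitLen m i = m (orbitCode m i).1) ∨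
    ((orbitCode m i).1 < (orbitCode m i).2.1 ∧ (orbitCode m i).2.2 = 0 ∧
      orbitLen m i = m (orbitCode m i).1 * m (orbitCode m i).2.1) := by
  rcases i with j | ⟨j, h, hh⟩ | ⟨⟨j, l⟩, hjl⟩
  · have := hm.three_le j
    left
    simp only [orbitCode, orbitLen, true_and, and_true]
    omega
  · have := hm.three_le j
    left
    simp only [orbitCode, orbitLen, true_and, and_true]
    rw [Finset.mem_Icc] at hh
    omega
  · right
    exact ⟨hjl, rfl, rfl⟩

theorem OddCoprime.totalPerm_pow_fst (hm : OddCoprime m) (i : OrbitIndex m) (k : ℕ) :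
    (totalPerm m ^ k) (orbitFst m i) = pt m (orbitCode m i).1 (-k) := by
  rw [totalPerm, orbitFst, hm.deltaAll_pow_perm_pt, zero_sub]

theorem OddCoprime.totalPerm_pow_snd (hm : OddCoprime m) (i : OrbitIndex m) (k : ℕ) :
    (totalPerm m ^ k) (orbitSnd m i) = pt m (orbitCode m i).2.1 ((orbitCode m i).2.2 - k) := by
  rw [totalPerm, orbitSnd, hm.deltaAll_pow_perm_pt]

/-- The pairs in the orbits of the representatives are pairwise different. -/
theorem OddCoprime.orbit_unique (hm : OddCoprime m) {i i' : OrbitIndex m} {k : ℕ}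
    (hk : k < orbitLen m i)
    (h : (orbitFst m i' = (totalPerm m ^ k) (orbitFst m i) ∧
        orbitSnd m i' = (totalPerm m ^ k) (orbitSnd m i)) ∨
      (orbitFst m i' = (totalPerm m ^ k) (orbitSnd m i) ∧
        orbitSnd m i' = (totalPerm m ^ k) (orbitFst m i))) : i = i' ∧ k = 0 := by
  have hc := hm.orbitCode_cases i
  have hc' := hm.orbitCode_cases i'
  rw [hm.totalPerm_pow_fst, hm.totalPerm_pow_snd, orbitFst, orbitSnd] at h
  have hinj := @orbitCode_injective t m i i'
  generalize orbitCode m i = c at *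
  generalize orbitCode m i' = c' at *
  obtain ⟨j, l, d⟩ := c
  obtain ⟨j', l', d'⟩ := c'
  simp only at *
  rcases h with ⟨h1, h2⟩ | ⟨h1, h2⟩
  · obtain rfl := hm.pt_block h1
    obtain rfl := hm.pt_block h2
    rw [hm.pt_eq_pt] at h1 h2
    rcases hc with ⟨rfl, hd1, hd2, hlen⟩ | ⟨hjl, rfl, hlen⟩
    · rcases hc' with ⟨-, hd1', hd2', -⟩ | ⟨hjl', -⟩
      · have h3 : (m j' : ℤ) ∣ k := by simpa using h1
        have hk0 : k = 0 := Nat.eq_zero_of_dvd_of_lt (by exact_mod_cast h3) (by omega)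
        subst hk0
        have := Int.eq_zero_of_abs_lt_dvd h2 (by rw [abs_lt]; constructor <;> push_cast <;> omega)
        have hd : d = d' := by push_cast at this; omega
        exact ⟨hinj (by rw [hd]), rfl⟩
      · exact absurd hjl' (lt_irrefl _)
    · rcases hc' with ⟨hjl', -⟩ | ⟨-, hd', -⟩
      · exact absurd hjl' hjl.ne
      · subst hd'
        have h3 : m j' ∣ k := by
          have : (m j' : ℤ) ∣ k := by simpa using h1
          exact_mod_cast this
        have h4 : m l' ∣ k := by
          have : (m l' : ℤ) ∣ k := by simpa using h2
          exact_mod_cast this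
        -- Coprimality makes the orbit between two blocks as long as the full product of their
        -- sizes.
        have := (hm.coprime hjl.ne).mul_dvd_of_dvd_of_dvd h3 h4
        exact ⟨hinj rfl, Nat.eq_zero_of_dvd_of_lt this (by omega)⟩
  · obtain rfl := hm.pt_block h1
    obtain rfl := hm.pt_block h2
    rw [hm.pt_eq_pt] at h1 h2
    rcases hc with ⟨rfl, hd1, hd2, hlen⟩ | ⟨hjl, -⟩
    · rcases hc' with ⟨-, hd1', hd2', -⟩ | ⟨hjl', -⟩
      -- A swapped match would make `m` divide `d + d'`, but `0 < d + d' < m` because both distances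
      -- are at most `(m - 1)/2`.
      · have h3 := dvd_sub h2 h1
        have h4 : (m l' : ℤ) ∣ ((d + d' : ℕ) : ℤ) := by
          have e : ((d + d' : ℕ) : ℤ) = d' - -k - (0 - (d - k)) := by push_cast; ring
          rw [e]
          exact h3
        have := Nat.le_of_dvd (by omega) (Int.natCast_dvd_natCast.1 h4)
        omega
      · exact absurd hjl' (lt_irrefl _)
    · rcases hc' with ⟨hjl', -⟩ | ⟨hjl', -⟩
      · exact absurd hjl' hjl.ne'
      · exact absurd hjl' hjl.asymm

/-- By `orbit_unique`, a representative is met only in its own orbit and there only at `k = 0`. This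
is the duality behind the basis. -/
theorem OddCoprime.sum_pairInd_orbit [DecidableEq (OrbitIndex m)] (hm : OddCoprime m)
    (i i' : OrbitIndex m) :
    ∑ k ∈ Finset.range (orbitLen m i), pairInd ((totalPerm m ^ k) (orbitFst m i))
      ((totalPerm m ^ k) (orbitSnd m i)) (orbitFst m i') (orbitSnd m i') =
      if i = i' then 1 else 0 := by
  have hpos : 0 < orbitLen m i := by
    have h3 := hm.three_le
    rcases hm.orbitCode_cases i with ⟨-, -, -, h⟩ | ⟨-, -, h⟩
    · rw [h]
      have := h3 (orbitCode m i).1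
      omega
    · rw [h]
      have := h3 (orbitCode m i).1
      have := h3 (orbitCode m i).2.1
      positivity
  split_ifs with h
  · subst h
    rw [Finset.sum_eq_single 0]
    · simp [pairInd]
    · intro k hk hk0
      rw [pairInd, if_neg]
      intro h
      refine hk0 (hm.orbit_unique (Finset.mem_range.1 hk) (h.imp id id)).2
    · intro h
      exact absurd (Finset.mem_range.2 hpos) h
  · refine Finset.sum_eq_zero fun k hk => ?_
    rw [pairInd, if_neg]
    intro h'
    exact h (hm.orbit_unique (Finset.mem_range.1 hk) (h'.imp id id)).1

/-- Every pair of points lies in the orbit of a representative. -/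
theorem OddCoprime.orbit_cover (hm : OddCoprime m) {x y : ℕ} (hx : 1 ≤ x ∧ x ≤ numStrings m)
    (hy : 1 ≤ y ∧ y ≤ numStrings m) (hxy : x ≠ y) : ∃ (i : OrbitIndex m) (k : ℕ),
      (x = (totalPerm m ^ k) (orbitFst m i) ∧ y = (totalPerm m ^ k) (orbitSnd m i)) ∨
      (y = (totalPerm m ^ k) (orbitFst m i) ∧ x = (totalPerm m ^ k) (orbitSnd m i)) := by
  have cross : ∀ j l u v, j < l → ∃ (i : OrbitIndex m) (k : ℕ),
      pt m j u = (totalPerm m ^ k) (orbitFst m i) ∧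
      pt m l v = (totalPerm m ^ k) (orbitSnd m i) := by
    intro j l u v hjl
    obtain ⟨k, hk⟩ := hm.exists_nat_dvd (fun z => if z = j then -u else -v)
    refine ⟨Sum.inr (Sum.inr ⟨(j, l), hjl⟩), k, ?_, ?_⟩
    · rw [hm.totalPerm_pow_fst]
      have h := hk j
      rw [if_pos rfl] at h
      refine hm.pt_eq_pt.2 ?_
      convert h using 1
      ring
    · rw [hm.totalPerm_pow_snd]
      have h := hk l
      rw [if_neg hjl.ne'] at h
      refine hm.pt_eq_pt.2 ?_
      convert h using 1
      simp [orbitCode]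
      ring
  have inner : ∀ j u (d : ℕ), 1 ≤ d → 2 * d + 1 ≤ m j → ∃ (i : OrbitIndex m) (k : ℕ),
      pt m j u = (totalPerm m ^ k) (orbitFst m i) ∧
      pt m j (u + d) = (totalPerm m ^ k) (orbitSnd m i) := by
    intro j u d hd1 hd2
    obtain ⟨i, hi⟩ : ∃ i, orbitCode m i = (j, j, d) := by
      rcases hd1.eq_or_lt with rfl | h
      · exact ⟨Sum.inl j, rfl⟩
      · refine ⟨Sum.inr (Sum.inl ⟨j, d - 1, ?_⟩), ?_⟩
        · rw [Finset.mem_Icc]; omega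
        · simp only [orbitCode]
          rw [Nat.sub_add_cancel hd1]
    obtain ⟨k, hk⟩ := hm.exists_nat_dvd (fun _ => -u)
    refine ⟨i, k, ?_, ?_⟩
    · rw [hm.totalPerm_pow_fst, hi, hm.pt_eq_pt]
      convert hk j using 1
      ring
    · rw [hm.totalPerm_pow_snd, hi, hm.pt_eq_pt]
      convert hk j using 1
      ring
  obtain ⟨j, hj⟩ := exists_inBlock hx.1 hx.2
  obtain ⟨l, hl⟩ := exists_inBlock hy.1 hy.2
  obtain ⟨u, rfl⟩ := exists_pt hj
  obtain ⟨v, rfl⟩ := exists_pt hl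
  rcases lt_trichotomy j l with h | h | h
  · obtain ⟨i, k, hik⟩ := cross j l u v h
    exact ⟨i, k, Or.inl hik⟩
  · subst h
    obtain ⟨c, hc⟩ := hm.odd j
    have h3 := hm.three_le j
    have hne : ¬(m j : ℤ) ∣ v - u := fun h => hxy (hm.pt_eq_pt.2 h).symm
    have hpos := Int.emod_nonneg (v - u) (b := m j) (by omega)
    have hlt := Int.emod_lt_of_pos (v - u) (b := m j) (by omega)
    have hz : (v - u) % m j ≠ 0 := fun h => hne (Int.dvd_of_emod_eq_zero h)
    have hdvd := dvd_emod_sub (v - u) (m j)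
    obtain ⟨d, hd⟩ := Int.eq_ofNat_of_zero_le hpos
    rw [hd] at hpos hlt hz hdvd
    -- As `m j` is odd, either `d` or `m j - d` is at most `(m j - 1)/2`; in the second case the
    -- points exchange roles.
    by_cases hdc : 2 * d + 1 ≤ m j
    · obtain ⟨i, k, h1, h2⟩ := inner j u d (by omega) hdc
      refine ⟨i, k, Or.inl ⟨h1, ?_⟩⟩
      rw [← h2, eq_comm, hm.pt_eq_pt]
      convert hdvd using 1
      ring
    · obtain ⟨i, k, h1, h2⟩ := inner j v (m j - d) (by omega) (by omega)
      refine ⟨i, k, Or.inr ⟨h1, ?_⟩⟩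
      rw [← h2, hm.pt_eq_pt]
      rw [Nat.cast_sub (by omega)]
      have := dvd_sub hdvd (dvd_refl (m j : ℤ))
      have e : u - (v + ((m j : ℤ) - d)) = d - (v - u) - m j := by ring
      rw [e]
      exact this
  · obtain ⟨i, k, hik⟩ := cross l j v u h
    exact ⟨i, k, Or.inr hik⟩

end Orbits

/-! ### Orbit products, centrality and divisibility in `Γ_q`. -/

section Center

variable {t : ℕ} {m : Fin t → ℕ}

theorem holonomyOrder_ne_zero (hm : OddCoprime m) : holonomyOrder m ≠ 0 :=
  Finset.prod_ne_zero_iff.2 fun j _ => by have := hm.three_le j; omega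

theorem blockHom_supported {g : BraidQuot (numStrings m)} (hg : (blockHom m g).perm = 1) :
    blockHom m g ∈ supported (numStrings m) := by
  have h := linkHom_supported g
  have e : blockHom m g = linkHom _ g := by
    ext x y
    · rw [blockHom_perm]
    · exact blockHom_cr hg x y
  rwa [e]

theorem blockHom_pureA_pow {r s : ℕ} (hr : 1 ≤ r) (hrs : r < s) (hs : s ≤ numStrings m) (q : ℕ) :
    blockHom m (pureA _ r s ^ q) = ⟨1, fun x y => 2 * q * pairInd r s x y⟩ := by
  rw [map_pow, blockHom_pureA hr hrs hs]
  ext x y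
  · simp
  · rw [pow_cr]
    simp
    ring

/-- `GammaQ` contains the power of a pure generator for each unordered pair of strings. -/
theorem exists_mem_GammaQ {r s : ℕ} (hr : 1 ≤ r ∧ r ≤ numStrings m)
    (hs : 1 ≤ s ∧ s ≤ numStrings m) (hrs : r ≠ s) :
    ∃ g ∈ GammaQ m, blockHom m g = ⟨1, fun x y => 2 * holonomyOrder m * pairInd r s x y⟩ := by
  rcases lt_or_gt_of_ne hrs with h | h
  · exact ⟨_, Subgroup.subset_closure (Or.inr ⟨r, s, hr.1, h, hs.2, rfl⟩),
      blockHom_pureA_pow hr.1 h hs.2 _⟩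
  · refine ⟨_, Subgroup.subset_closure (Or.inr ⟨s, r, hs.1, h, hr.2, rfl⟩), ?_⟩
    rw [blockHom_pureA_pow hs.1 h hr.2 _]
    simp only [pairInd_swap s r]

theorem perm_mem_Icc (g : BraidQuot (numStrings m)) {x : ℕ} (hx : 1 ≤ x ∧ x ≤ numStrings m) :
    1 ≤ (blockHom m g).perm x ∧ (blockHom m g).perm x ≤ numStrings m := by
  by_contra h
  have h1 := (linkHom_supported g).1 _ h
  rw [← blockHom_perm] at h1
  rw [(blockHom m g).perm.injective h1] at h
  exact h hx

theorem totalPerm_pow (k : ℕ) : totalPerm m ^ k = (blockHom m (deltaAll m ^ k)).perm := by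
  rw [map_pow, pow_perm, totalPerm]

theorem OddCoprime.rep_mem (hm : OddCoprime m) (i : OrbitIndex m) :
    (1 ≤ orbitFst m i ∧ orbitFst m i ≤ numStrings m) ∧
    (1 ≤ orbitSnd m i ∧ orbitSnd m i ≤ numStrings m) ∧ orbitFst m i ≠ orbitSnd m i := by
  refine ⟨(hm.pt_mem _ _).mem, (hm.pt_mem _ _).mem, fun h => ?_⟩
  have h1 := hm.pt_block h
  rcases hm.orbitCode_cases i with ⟨-, h2, h3, -⟩ | ⟨h2, -⟩
  · rw [orbitFst, orbitSnd, ← h1, hm.pt_eq_pt] at h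
    have := Int.eq_zero_of_abs_lt_dvd h (by rw [abs_lt]; constructor <;> omega)
    omega
  · exact h2.ne h1

/-- Conjugates of the powers of the pure generators by powers of `δ`. -/
theorem conj_deltaAll_pow {r s : ℕ} (hr : 1 ≤ r) (hrs : r < s) (hs : s ≤ numStrings m) (k : ℕ) :
    deltaAll m ^ k * pureA _ r s ^ holonomyOrder m * (deltaAll m ^ k)⁻¹ ∈ GammaQ m ∧
    (blockHom m (deltaAll m ^ k * pureA _ r s ^ holonomyOrder m * (deltaAll m ^ k)⁻¹)).perm = 1 ∧
    ∀ x y, (blockHom m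
      (deltaAll m ^ k * pureA _ r s ^ holonomyOrder m * (deltaAll m ^ k)⁻¹)).cr x y =
      2 * holonomyOrder m * pairInd ((totalPerm m ^ k) r) ((totalPerm m ^ k) s) x y := by
  have h0 := blockHom_pureA_pow hr hrs hs (holonomyOrder m)
  have hp : (blockHom m (pureA _ r s ^ holonomyOrder m)).perm = 1 := by rw [h0]
  have h1 : (blockHom m
      (deltaAll m ^ k * pureA _ r s ^ holonomyOrder m * (deltaAll m ^ k)⁻¹)).perm = 1 := by
    rw [map_mul, map_mul, map_inv, conj_perm hp]
  have h2 : ∀ x y, (blockHom m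
      (deltaAll m ^ k * pureA _ r s ^ holonomyOrder m * (deltaAll m ^ k)⁻¹)).cr x y =
      2 * holonomyOrder m * pairInd ((totalPerm m ^ k) r) ((totalPerm m ^ k) s) x y := by
    intro x y
    rw [map_mul, map_mul, map_inv, conj_cr hp, h0, ← totalPerm_pow]
    simp only [pairInd_perm, inv_inv]
  refine ⟨?_, h1, h2⟩
  obtain ⟨g, hg, hgc⟩ := exists_mem_GammaQ (m := m) (r := (totalPerm m ^ k) r)
    (s := (totalPerm m ^ k) s) (by rw [totalPerm_pow]; exact perm_mem_Icc _ ⟨hr, by omega⟩)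
    (by rw [totalPerm_pow]; exact perm_mem_Icc _ ⟨by omega, hs⟩)
    (fun h => hrs.ne ((totalPerm m ^ k).injective h))
  convert hg
  apply blockHom_injective
  rw [hgc]
  ext x y
  · rw [h1]
  · exact h2 x y

theorem OddCoprime.orbit_prod_conj (hm : OddCoprime m) (i : OrbitIndex m)
    (h : orbitFst m i < orbitSnd m i) (M : ℕ) :
    ((List.range' 1 M).map fun k => deltaAll m ^ (k - 1) *
      pureA _ (orbitFst m i) (orbitSnd m i) ^ holonomyOrder m * (deltaAll m ^ (k - 1))⁻¹).prod ∈
        GammaQ m ∧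
    (blockHom m ((List.range' 1 M).map fun k => deltaAll m ^ (k - 1) *
      pureA _ (orbitFst m i) (orbitSnd m i) ^ holonomyOrder m *
        (deltaAll m ^ (k - 1))⁻¹).prod).perm = 1 ∧
    ∀ x y, (blockHom m ((List.range' 1 M).map fun k => deltaAll m ^ (k - 1) *
      pureA _ (orbitFst m i) (orbitSnd m i) ^ holonomyOrder m *
        (deltaAll m ^ (k - 1))⁻¹).prod).cr x y =
      2 * holonomyOrder m * ∑ k ∈ Finset.range M, pairInd ((totalPerm m ^ k) (orbitFst m i))
        ((totalPerm m ^ k) (orbitSnd m i)) x y := by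
  obtain ⟨h1, h2, -⟩ := hm.rep_mem i
  have key := conj_deltaAll_pow h1.1 h h2.2
  have e : (List.range' 1 M) = (List.range M).map fun k => 1 + k := by
    rw [List.range'_eq_map_range]
  rw [e, List.map_map]
  simp only [Function.comp_def, Nat.add_sub_cancel_left]
  refine ⟨Subgroup.list_prod_mem _ ?_, ?_⟩
  · simp only [List.mem_map]
    rintro _ ⟨k, -, rfl⟩
    exact (key k).1
  · rw [map_list_prod, List.map_map]
    have := list_prod_perm_cr (fun k => blockHom m (deltaAll m ^ k *
      pureA _ (orbitFst m i) (orbitSnd m i) ^ holonomyOrder m * (deltaAll m ^ k)⁻¹))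
      (fun k => (key k).2.1) M
    refine ⟨this.1, fun x y => (this.2 x y).trans ?_⟩
    rw [Finset.mul_sum]
    exact Finset.sum_congr rfl fun k _ => (key k).2.2 x y

theorem OddCoprime.blockDelta_pow_perm_pt (hm : OddCoprime m) (k : ℕ) (j : Fin t) (u : ℤ) :
    ((blockHom m (blockDelta m j)).perm ^ k) (pt m j u) = pt m j (u - k) := by
  induction k with
  | zero => simp
  | succ k ih =>
    rw [pow_succ', Equiv.Perm.mul_apply, ih, hm.blockDelta_perm_pt, if_pos rfl]
    push_cast
    ring_nf

/-- After normalization the block generator is `A` times a bare `m j`-cycle, so its `m j`-th power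
is pure and collects the translates of one edge, each edge of the cycle once. -/
theorem OddCoprime.eFixed_eval (hm : OddCoprime m) (j : Fin t) :
    (blockHom m (eFixed m j)).perm = 1 ∧ ∀ x y, (blockHom m (eFixed m j)).cr x y =
      2 * ∑ k ∈ Finset.range (m j), pairInd ((totalPerm m ^ k) (pt m j 0))
        ((totalPerm m ^ k) (pt m j 1)) x y := by
  set π := (blockHom m (blockDelta m j)).perm with hπ
  refine ⟨?_, fun x y => ?_⟩
  · have h1 : (blockHom m (eFixed m j)).perm = (blockHom m (blockDelta m j ^ m j)).perm := by
      rw [eFixed, map_pow, map_pow, pow_perm, pow_perm, hm.blockGen_perm]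
    rw [h1, ← one_perm, ← map_one (blockHom m)]
    refine perm_eq_of_pt fun l u => ?_
    rw [map_pow, pow_perm, map_one, one_perm, Equiv.Perm.one_apply]
    by_cases h : l = j
    · subst h
      rw [hm.blockDelta_pow_perm_pt, hm.pt_eq_pt]
      simp
    · have hfix : (blockHom m (blockDelta m j)).perm (pt m l u) = pt m l u := by
        rw [hm.blockDelta_perm_pt, if_neg h]
      exact Equiv.Perm.pow_apply_eq_self_of_apply_eq_self hfix _
  · have hinv : ∀ (k : ℕ) (u : ℤ), (π ^ k)⁻¹ (pt m j u) = pt m j (u + k) := by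
      intro k u
      rw [Equiv.Perm.inv_eq_iff_eq, hπ, hm.blockDelta_pow_perm_pt, add_sub_cancel_right]
    -- Powers pull pairs back, whereas the orbit sum moves them forward; after reflecting the sum,
    -- the pullback by `m j - k` steps equals `k` steps forward.
    rw [eFixed, map_pow, pow_cr, hm.blockGen_perm, ← hπ, Finset.mul_sum,
      ← Finset.sum_range_reflect]
    refine Finset.sum_congr rfl fun k hk => ?_
    rw [Finset.mem_range] at hk
    rw [hm.blockGen_cr, ← hπ, ← Equiv.Perm.mul_apply, ← Equiv.Perm.mul_apply, ← pow_succ',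
      pairInd_perm, hinv, hinv, totalPerm, hm.deltaAll_pow_perm_pt, hm.deltaAll_pow_perm_pt]
    have e : ((m j - 1 - k + 1 : ℕ) : ℤ) = m j - k := by omega
    have e1 : pt m j (0 + ((m j - 1 - k + 1 : ℕ) : ℤ)) = pt m j (0 - k) := by
      rw [hm.pt_eq_pt, e]
      simp
    have e2 : pt m j (1 + ((m j - 1 - k + 1 : ℕ) : ℤ)) = pt m j (1 - k) := by
      rw [hm.pt_eq_pt, e]
      ring_nf
      exact dvd_refl _
    rw [e1, e2]

theorem OddCoprime.orbitProd_eval (hm : OddCoprime m) (i : OrbitIndex m) :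
    orbitProd m i ∈ GammaQ m ∧ (blockHom m (orbitProd m i)).perm = 1 ∧
    ∀ x y, (blockHom m (orbitProd m i)).cr x y = 2 * orbitWeight m i *
      ∑ k ∈ Finset.range (orbitLen m i), pairInd ((totalPerm m ^ k) (orbitFst m i))
        ((totalPerm m ^ k) (orbitSnd m i)) x y := by
  rcases i with j | ⟨j, h, hh⟩ | ⟨⟨j, l⟩, hjl⟩
  · have hmem : blockGen m j ∈ GammaQ m := Subgroup.subset_closure (Or.inl ⟨j, rfl⟩)
    refine ⟨Subgroup.pow_mem _ hmem (m j), (hm.eFixed_eval j).1, fun x y => ((hm.eFixed_eval j).2 x y).trans ?_⟩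
    simp [orbitWeight, orbitLen, orbitFst, orbitSnd, orbitCode]
  · have h3 := hm.three_le j
    have hh' := Finset.mem_Icc.1 hh
    have e0 : orbitFst m (Sum.inr (Sum.inl ⟨j, h, hh⟩)) = blockStart m j + 1 :=
      pt_eq_of_lt (m := m) (j := j) (d := 0) (by omega)
    have e1 : orbitSnd m (Sum.inr (Sum.inl ⟨j, h, hh⟩)) = blockStart m j + h + 2 := by
      refine (pt_eq_of_lt (m := m) (j := j) (d := h + 1) (by omega)).trans ?_
      ring
    have := hm.orbit_prod_conj (Sum.inr (Sum.inl ⟨j, h, hh⟩)) (by rw [e0, e1]; omega) (m j)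
    rw [e0, e1] at this ⊢
    exact this
  · have h3 := hm.three_le
    have e0 : orbitFst m (Sum.inr (Sum.inr ⟨(j, l), hjl⟩)) = blockStart m j + 1 :=
      pt_eq_of_lt (m := m) (j := j) (d := 0) (by have := h3 j; omega)
    have e1 : orbitSnd m (Sum.inr (Sum.inr ⟨(j, l), hjl⟩)) = blockStart m l + 1 :=
      pt_eq_of_lt (m := m) (j := l) (d := 0) (by have := h3 l; omega)
    have hlt := blockStart_add_le m hjl
    have := hm.orbit_prod_conj (Sum.inr (Sum.inr ⟨(j, l), hjl⟩))
      (by rw [e0, e1]; have := h3 j; simp only at hlt; omega) (m j * m l)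
    rw [e0, e1] at this ⊢
    exact this

theorem OddCoprime.totalPerm_pow_orbitLen (hm : OddCoprime m) (i : OrbitIndex m) :
    (totalPerm m ^ orbitLen m i) (orbitFst m i) = orbitFst m i ∧
    (totalPerm m ^ orbitLen m i) (orbitSnd m i) = orbitSnd m i := by
  rw [hm.totalPerm_pow_fst, hm.totalPerm_pow_snd, orbitFst, orbitSnd, hm.pt_eq_pt, hm.pt_eq_pt]
  rcases hm.orbitCode_cases i with ⟨h, -, -, hl⟩ | ⟨-, -, hl⟩ <;> rw [hl]
  · rw [← h]
    simp
  · push_cast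
    constructor
    · simp
    · simp

/-- Moving the points shifts the summation index by one, and the first and last terms agree because
the orbit closes up after `orbitLen` steps. -/
theorem OddCoprime.orbitProd_invariant (hm : OddCoprime m) (i : OrbitIndex m) :
    totalPerm m ∈ invariance (blockHom m (orbitProd m i)).cr := by
  rw [← inv_mem_iff]
  intro x y
  obtain ⟨-, -, h⟩ := hm.orbitProd_eval i
  rw [h, h]
  congr 1
  have hstep : ∀ k, pairInd ((totalPerm m ^ k) (orbitFst m i)) ((totalPerm m ^ k) (orbitSnd m i))
      ((totalPerm m)⁻¹ x) ((totalPerm m)⁻¹ y) =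
      pairInd ((totalPerm m ^ (k + 1)) (orbitFst m i))
        ((totalPerm m ^ (k + 1)) (orbitSnd m i)) x y := by
    intro k
    rw [pairInd_perm, inv_inv, pow_succ', Equiv.Perm.mul_apply, Equiv.Perm.mul_apply]
  simp only [hstep]
  have h1 := Finset.sum_range_succ (fun k => pairInd ((totalPerm m ^ k) (orbitFst m i))
    ((totalPerm m ^ k) (orbitSnd m i)) x y) (orbitLen m i)
  rw [Finset.sum_range_succ', (hm.totalPerm_pow_orbitLen i).1,
    (hm.totalPerm_pow_orbitLen i).2] at h1
  simpa using h1

/-- Pure elements with invariant crossing numbers commute with all elements of `GammaQ`. -/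
theorem OddCoprime.commute_of_invariant (hm : OddCoprime m) {g : BraidQuot (numStrings m)}
    (hg : (blockHom m g).perm = 1) (hinv : totalPerm m ∈ invariance (blockHom m g).cr)
    {h : BraidQuot (numStrings m)} (hh : h ∈ GammaQ m) : g * h = h * g := by
  suffices hle : GammaQ m ≤ (invariance (blockHom m g).cr).comap
      (permHom.comp (blockHom m)) by
    apply blockHom_injective
    rw [map_mul, map_mul]
    exact (mul_comm_iff hg _).2 (hle hh)
  rw [GammaQ, Subgroup.closure_le]
  rintro _ (⟨j, rfl⟩ | ⟨r, s, hr, hrs, hs, rfl⟩)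
  · obtain ⟨e, he⟩ := hm.blockDelta_perm_eq_pow j
    rw [SetLike.mem_coe, Subgroup.mem_comap, MonoidHom.comp_apply, permHom_apply,
      hm.blockGen_perm, he]
    exact Subgroup.pow_mem _ hinv e
  · rw [SetLike.mem_coe, Subgroup.mem_comap, MonoidHom.comp_apply, permHom_apply,
      blockHom_pureA_pow hr hrs hs]
    exact Subgroup.one_mem _

theorem OddCoprime.totalPerm_mem_invariance (hm : OddCoprime m) {g : BraidQuot (numStrings m)}
    (hg : (blockHom m g).perm = 1) (hcomm : ∀ h ∈ GammaQ m, g * h = h * g) :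
    totalPerm m ∈ invariance (blockHom m g).cr := by
  rw [totalPerm, ← permHom_apply, ← MonoidHom.comp_apply, deltaAll, map_list_prod]
  refine Subgroup.list_prod_mem _ ?_
  simp only [List.mem_map, List.mem_ofFn]
  rintro _ ⟨_, ⟨j, rfl⟩, rfl⟩
  have h := congrArg (blockHom m) (hcomm _ (Subgroup.subset_closure (Or.inl ⟨j, rfl⟩)))
  rw [map_mul, map_mul, mul_comm_iff hg, hm.blockGen_perm] at h
  exact h

/-- Commuting with `A_{r,s}^q` forces the permutation to preserve `{r, s}`. A block provides at
least three strings, and `{x, y}` and `{x, z}` meet only in `x`. -/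
theorem OddCoprime.perm_eq_one (hm : OddCoprime m) {g : BraidQuot (numStrings m)}
    (hcomm : ∀ h ∈ GammaQ m, g * h = h * g) : (blockHom m g).perm = 1 := by
  set π := (blockHom m g).perm with hπ
  have key : ∀ r s, 1 ≤ r ∧ r ≤ numStrings m → 1 ≤ s ∧ s ≤ numStrings m → r ≠ s →
      (π r = r ∧ π s = s) ∨ (π r = s ∧ π s = r) := by
    intro r s hr hs hrs
    obtain ⟨a, ha, hac⟩ := exists_mem_GammaQ hr hs hrs
    have h := congrArg (blockHom m) (hcomm a ha).symm
    rw [map_mul, map_mul, mul_comm_iff (by rw [hac])] at h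
    have h1 := h r s
    rw [hac] at h1
    have hq := holonomyOrder_ne_zero hm
    simp only [← hπ, pairInd] at h1
    by_contra hne
    rw [if_neg hne, if_pos (by simp)] at h1
    simp [hq] at h1
  ext x
  rw [Equiv.Perm.one_apply]
  by_cases hx : 1 ≤ x ∧ x ≤ numStrings m
  · obtain ⟨j, hj⟩ := exists_inBlock hx.1 hx.2
    have h1 := hm.three_le j
    have h2 := blockStart_add_le_numStrings m j
    obtain ⟨y, z, hy, hz, hxy, hxz, hyz⟩ : ∃ y z, (1 ≤ y ∧ y ≤ numStrings m) ∧
        (1 ≤ z ∧ z ≤ numStrings m) ∧ x ≠ y ∧ x ≠ z ∧ y ≠ z := by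
      rcases lt_trichotomy x 2 with h | h | h
      · exact ⟨2, 3, by omega⟩
      · exact ⟨1, 3, by omega⟩
      · exact ⟨1, 2, by omega⟩
    have k1 := key x y hx hy hxy
    have k2 := key x z hx hz hxz
    omega
  · rw [hπ, blockHom_perm]
    exact (linkHom_supported g).1 x hx

/-- Pure elements with invariant crossing numbers are determined by the representatives of the
orbits. -/
theorem OddCoprime.eq_one_of_invariant (hm : OddCoprime m) {g : BraidQuot (numStrings m)}
    (hg : (blockHom m g).perm = 1) (hinv : totalPerm m ∈ invariance (blockHom m g).cr)
    (h0 : ∀ i, (blockHom m g).cr (orbitFst m i) (orbitSnd m i) = 0) : g = 1 := by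
  apply blockHom_injective
  rw [map_one]
  obtain ⟨-, hsymm, hdiag, hout⟩ := blockHom_supported hg
  ext x y
  · rw [hg, one_perm]
  · rw [one_cr]
    by_cases hx : 1 ≤ x ∧ x ≤ numStrings m
    · by_cases hy : 1 ≤ y ∧ y ≤ numStrings m
      · rcases eq_or_ne x y with rfl | hxy
        · exact hdiag x
        · obtain ⟨i, k, ⟨rfl, rfl⟩ | ⟨rfl, rfl⟩⟩ := hm.orbit_cover hx hy hxy
          · rw [(Subgroup.pow_mem _ hinv k : _ ∈ invariance _), h0]
          · rw [(Subgroup.pow_mem _ hinv k : _ ∈ invariance _), hsymm, h0]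
      · rw [hsymm]
        exact hout y x hy
    · exact hout x y hx

/-- Two points are cyclic neighbours in a block. -/
def CyclicAdj (m : Fin t → ℕ) (x y : ℕ) : Prop :=
  ∃ j u, (x = pt m j u ∧ y = pt m j (u + 1)) ∨ (y = pt m j u ∧ x = pt m j (u + 1))

/-- A block generator adds crossings only at cyclic neighbours, a relation which all permutations
from `Γ_q` preserve; elsewhere only the `q`-th powers contribute. The first half is what carries the
divisibility through products and inverses. -/
theorem OddCoprime.cr_dvd (hm : OddCoprime m) {g : BraidQuot (numStrings m)} (hg : g ∈ GammaQ m) :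
    (∀ x y, CyclicAdj m ((blockHom m g).perm x) ((blockHom m g).perm y) ↔ CyclicAdj m x y) ∧
    ∀ x y, ¬CyclicAdj m x y → (2 * holonomyOrder m : ℤ) ∣ (blockHom m g).cr x y := by
  rw [GammaQ] at hg
  induction hg using Subgroup.closure_induction with
  | mem g hg =>
    rcases hg with ⟨j, rfl⟩ | ⟨r, s, hr, hrs, hs, rfl⟩
    · set π := (blockHom m (blockDelta m j)).perm with hπ
      have hpt : ∀ l u, π (pt m l u) = pt m l (if l = j then u - 1 else u) :=
        fun l u => hm.blockDelta_perm_pt j l u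
      have hpt' : ∀ l u, π⁻¹ (pt m l u) = pt m l (if l = j then u + 1 else u) := by
        intro l u
        rw [Equiv.Perm.inv_eq_iff_eq, hpt]
        split_ifs <;> simp
      have hadj : ∀ x y, CyclicAdj m x y → CyclicAdj m (π x) (π y) := by
        rintro x y ⟨l, u, ⟨rfl, rfl⟩ | ⟨rfl, rfl⟩⟩ <;>
          refine ⟨l, if l = j then u - 1 else u, ?_⟩ <;> rw [hpt, hpt] <;> split_ifs <;> simp
      have hadj' : ∀ x y, CyclicAdj m x y → CyclicAdj m (π⁻¹ x) (π⁻¹ y) := by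
        rintro x y ⟨l, u, ⟨rfl, rfl⟩ | ⟨rfl, rfl⟩⟩ <;>
          refine ⟨l, if l = j then u + 1 else u, ?_⟩ <;> rw [hpt', hpt'] <;> split_ifs <;> simp
      have hiff : ∀ x y, CyclicAdj m (π x) (π y) ↔ CyclicAdj m x y := by
        refine fun x y => ⟨fun h => ?_, hadj x y⟩
        have := hadj' _ _ h
        simpa using this
      rw [hm.blockGen_perm, ← hπ]
      refine ⟨hiff, fun x y hxy => ?_⟩
      rw [hm.blockGen_cr, ← hπ, pairInd, if_neg, mul_zero]
      · exact dvd_zero _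
      · rintro (⟨h1, h2⟩ | ⟨h1, h2⟩)
        · exact hxy ((hiff x y).1 ⟨j, 0, Or.inl ⟨h1, h2⟩⟩)
        · exact hxy ((hiff x y).1 ⟨j, 0, Or.inr ⟨h2, h1⟩⟩)
    · rw [blockHom_pureA_pow hr hrs hs]
      exact ⟨fun _ _ => Iff.rfl, fun _ _ _ => dvd_mul_right _ _⟩
  | one => simp
  | mul g h _ _ ihg ihh =>
    refine ⟨fun x y => ?_, fun x y hxy => ?_⟩
    · rw [map_mul, mul_perm, Equiv.Perm.mul_apply, Equiv.Perm.mul_apply, ihg.1, ihh.1]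
    · rw [map_mul, mul_cr]
      exact dvd_add (ihg.2 _ _ (by rwa [ihh.1])) (ihh.2 _ _ hxy)
  | inv g _ ih =>
    have h1 : ∀ x y, CyclicAdj m ((blockHom m g).perm⁻¹ x) ((blockHom m g).perm⁻¹ y) ↔
        CyclicAdj m x y := by
      intro x y
      rw [← ih.1]
      simp
    refine ⟨fun x y => ?_, fun x y hxy => ?_⟩
    · rw [map_inv, inv_perm, h1]
    · rw [map_inv, inv_cr, dvd_neg]
      exact ih.2 _ _ (by rwa [h1])

/-- At distance 1 evenness of pure crossing numbers suffices. The other representatives are not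
neighbours: they lie in different blocks, or at distance `2 ≤ d ≤ (m - 1)/2`, which is not `±1`
modulo `m`. -/
theorem OddCoprime.weight_dvd (hm : OddCoprime m) {g : BraidQuot (numStrings m)}
    (hg : g ∈ GammaQ m) (hp : (blockHom m g).perm = 1) (i : OrbitIndex m) :
    (2 * orbitWeight m i : ℤ) ∣ (blockHom m g).cr (orbitFst m i) (orbitSnd m i) := by
  have key : orbitWeight m i = holonomyOrder m → (orbitCode m i).2.2 ≠ 1 →
      (2 * orbitWeight m i : ℤ) ∣ (blockHom m g).cr (orbitFst m i) (orbitSnd m i) := by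
    intro h1 h2
    rw [h1]
    refine (hm.cr_dvd hg).2 _ _ ?_
    have hadj : ∀ j u, ¬ (orbitFst m i = pt m j u ∧ orbitSnd m i = pt m j (u + 1)) ∧
        ¬ (orbitSnd m i = pt m j u ∧ orbitFst m i = pt m j (u + 1)) := by
      intro j u
      rw [orbitFst, orbitSnd]
      rcases hm.orbitCode_cases i with ⟨-, h3, h4, -⟩ | ⟨h3, -⟩
      · constructor
        · rintro ⟨h5, h6⟩
          have e5 := hm.pt_block h5
          have e6 := hm.pt_block h6
          rw [e5, hm.pt_eq_pt] at h5
          rw [e6, hm.pt_eq_pt] at h6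
          rw [e5] at h4
          have h7 := Int.eq_zero_of_abs_lt_dvd (dvd_sub h6 h5)
            (by rw [abs_lt]; constructor <;> omega)
          omega
        · rintro ⟨h5, h6⟩
          have e5 := hm.pt_block h5
          have e6 := hm.pt_block h6
          rw [e5, hm.pt_eq_pt] at h5
          rw [e6, hm.pt_eq_pt] at h6
          rw [e6] at h4
          have h7 := Int.eq_zero_of_abs_lt_dvd (dvd_sub h5 h6)
            (by rw [abs_lt]; constructor <;> omega)
          omega
      · constructor
        · rintro ⟨h5, h6⟩
          exact h3.ne ((hm.pt_block h5).trans (hm.pt_block h6).symm)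
        · rintro ⟨h5, h6⟩
          exact h3.ne ((hm.pt_block h6).trans (hm.pt_block h5).symm)
    rintro ⟨j, u, h | h⟩
    · exact (hadj j u).1 h
    · exact (hadj j u).2 h
  rcases i with j | ⟨j, h, hh⟩ | ⟨⟨j, l⟩, hjl⟩
  · rw [blockHom_cr hp]
    simp only [orbitWeight, Nat.cast_one, mul_one]
    rw [blockHom_perm] at hp
    exact pure_cr_even hp _ _
  · refine key rfl ?_
    rw [Finset.mem_Icc] at hh
    simp only [orbitCode]
    omega
  · exact key rfl (by simp [orbitCode])

end Center

/-! ### A criterion for bases, the rank, and the theorem. -/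

/-- A family that is dual, up to nonzero multiples, to a separating family of functionals with
values in the corresponding multiples is a basis. -/
theorem exists_basis_of_eval {M ι : Type*} [AddCommGroup M] [Fintype ι] [DecidableEq ι]
    (V : ι → M) (ev : ι → M →+ ℤ) (w : ι → ℤ) (hw : ∀ i, w i ≠ 0)
    (hV : ∀ i k, ev k (V i) = if i = k then w k else 0) (hdvd : ∀ k x, w k ∣ ev k x)
    (hinj : ∀ x, (∀ k, ev k x = 0) → x = 0) :
    ∃ b : Module.Basis ι ℤ M, ∀ i, b i = V i := by
  have hsum : ∀ (c : ι → ℤ) k, ev k (∑ i, c i • V i) = c k * w k := by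
    intro c k
    rw [map_sum, Finset.sum_eq_single k]
    · rw [map_zsmul, hV, if_pos rfl, smul_eq_mul]
    · intro i _ hi
      rw [map_zsmul, hV, if_neg hi, smul_zero]
    · simp
  have hli : LinearIndependent ℤ V := by
    rw [Fintype.linearIndependent_iff]
    intro c hc k
    have h := hsum c k
    rw [hc, map_zero] at h
    exact (mul_eq_zero.1 h.symm).resolve_right (hw k)
  have hspan : ⊤ ≤ Submodule.span ℤ (Set.range V) := by
    intro x _
    -- The coordinates of `x` are the quotients `ev k x / w k`.
    choose c hc using fun k => hdvd k x
    have : x = ∑ i, c i • V i := by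
      rw [← sub_eq_zero]
      refine hinj _ fun k => ?_
      rw [map_sub, hsum, hc k]
      ring
    rw [this]
    exact Submodule.sum_mem _ fun i _ =>
      Submodule.smul_mem _ _ (Submodule.subset_span ⟨i, rfl⟩)
  exact ⟨Module.Basis.mk hli hspan, fun i => Module.Basis.mk_apply hli hspan i⟩

theorem card_lt_pairs (t : ℕ) :
    Fintype.card {x : Fin t × Fin t // x.1 < x.2} = t * (t - 1) / 2 := by
  rw [Fintype.card_subtype, Finset.card_filter, Fintype.sum_prod_type_right]
  simp only [← Finset.card_filter]
  have : ∀ l : Fin t, (Finset.univ.filter fun j => j < l).card = l := fun l => by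
    rw [Finset.filter_gt_eq_Iio, Fin.card_Iio]
  simp only [this]
  rw [Fin.sum_univ_eq_sum_range (fun i => i), Finset.sum_range_id]

section Basis

variable {t : ℕ} {m : Fin t → ℕ}

/-- Each block contributes its distance-1 orbit and `(m j - 3)/2` further ones, together `(m j -
1)/2`. -/
theorem OddCoprime.card_orbitIndex (hm : OddCoprime m) :
    Fintype.card (OrbitIndex m) = (∑ j, (m j - 1) / 2) + t * (t - 1) / 2 := by
  rw [Fintype.card_sum, Fintype.card_sum, Fintype.card_sigma, card_lt_pairs, ← add_assoc]
  congr 1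
  simp only [Fintype.card_fin, Fintype.card_coe, Nat.card_Icc, Nat.add_sub_cancel]
  have : ∀ s : ℕ, t + s = ∑ _j : Fin t, 1 + s := fun s => by simp
  rw [this, ← Finset.sum_add_distrib]
  refine Finset.sum_congr rfl fun j _ => ?_
  have := hm.three_le j
  omega

theorem OddCoprime.center_comm {g : Subgroup.center (GammaQ m)}
    {h : BraidQuot (numStrings m)} (hh : h ∈ GammaQ m) :
    ((g : GammaQ m) : BraidQuot (numStrings m)) * h = h * (g : GammaQ m) :=
  (congrArg Subtype.val (Subgroup.mem_center_iff.1 g.2 ⟨h, hh⟩)).symm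

theorem OddCoprime.center_perm (hm : OddCoprime m) (g : Subgroup.center (GammaQ m)) :
    (blockHom m ((g : GammaQ m) : BraidQuot (numStrings m))).perm = 1 :=
  hm.perm_eq_one fun _ hh => center_comm hh

/-- The crossing number of a central element at the representative of an orbit. -/
noncomputable def OddCoprime.centerEval (hm : OddCoprime m) (i : OrbitIndex m) :
    Additive (Subgroup.center (GammaQ m)) →+ ℤ where
  toFun g := (blockHom m ((g.toMul : GammaQ m) : BraidQuot (numStrings m))).cr
    (orbitFst m i) (orbitSnd m i)
  map_zero' := by simp
  map_add' g h := by
    rw [toMul_add, Subgroup.coe_mul, Subgroup.coe_mul, map_mul, mul_cr, hm.center_perm]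
    rfl

/-- The product over an orbit as a central element. -/
noncomputable def OddCoprime.centerProd (hm : OddCoprime m) (i : OrbitIndex m) :
    Additive (Subgroup.center (GammaQ m)) :=
  Additive.ofMul ⟨⟨orbitProd m i, (hm.orbitProd_eval i).1⟩, Subgroup.mem_center_iff.2 fun h =>
    Subtype.ext (hm.commute_of_invariant (hm.orbitProd_eval i).2.1 (hm.orbitProd_invariant i)
      h.2).symm⟩

theorem OddCoprime.exists_center_basis (hm : OddCoprime m) :
    ∃ b : Module.Basis (OrbitIndex m) ℤ (Additive (Subgroup.center (GammaQ m))),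
      ∀ i, (((b i).toMul : GammaQ m) : BraidQuot (numStrings m)) = orbitProd m i := by
  classical
  refine (exists_basis_of_eval hm.centerProd hm.centerEval
    (fun i => 2 * (orbitWeight m i : ℤ)) ?_ ?_ ?_ ?_).imp fun b hb i => ?_
  · intro i
    have := holonomyOrder_ne_zero hm
    rcases i with j | i <;> simp [orbitWeight, this]
  · intro i k
    refine ((hm.orbitProd_eval i).2.2 _ _).trans ?_
    rw [hm.sum_pairInd_orbit]
    split_ifs with h
    · rw [h, mul_one]
    · rw [mul_zero]
  · intro k g
    exact hm.weight_dvd (g.toMul : GammaQ m).2 (hm.center_perm _) k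
  · intro g hg
    have hp := hm.center_perm g.toMul
    have h1 := hm.eq_one_of_invariant hp
      (hm.totalPerm_mem_invariance hp fun _ hh => center_comm hh) hg
    exact Additive.toMul.injective (Subtype.ext (Subtype.ext h1))
  · rw [hb]
    rfl

end Basis

theorem oddCoprime_prime_pow {t : ℕ} (p r : Fin t → ℕ) (hp : ∀ i, (p i).Prime)
    (hodd : ∀ i, Odd (p i)) (hinj : Function.Injective p) (hr : ∀ i, 1 ≤ r i) :
    OddCoprime fun i => p i ^ r i where
  odd i := (hodd i).pow
  three_le i := by
    have h1 := (hp i).two_le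
    have h2 := Nat.le_self_pow (n := r i) (by have := hr i; omega) (p i)
    obtain ⟨c, hc⟩ := hodd i
    show 3 ≤ p i ^ r i
    omega
  coprime i j hij :=
    Nat.Coprime.pow _ _ ((Nat.coprime_primes (hp i) (hp j)).2 fun h => hij (hinj h))

theorem theorem4p3 {t : ℕ} (p r : Fin t → ℕ) (hp : ∀ i, (p i).Prime) (hodd : ∀ i, Odd (p i))
    (hinj : Function.Injective p) (hr : ∀ i, 1 ≤ r i) :
    Module.Free ℤ (Additive (Subgroup.center (GammaQ fun i => p i ^ r i))) ∧
    Module.Finite ℤ (Additive (Subgroup.center (GammaQ fun i => p i ^ r i))) ∧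
    Module.finrank ℤ (Additive (Subgroup.center (GammaQ fun i => p i ^ r i))) =
      (∑ i, (p i ^ r i - 1) / 2) + t * (t - 1) / 2 ∧
    ∃ b : Module.Basis (OrbitIndex fun i => p i ^ r i) ℤ
        (Additive (Subgroup.center (GammaQ fun i => p i ^ r i))),
      ∀ x, (((b x).toMul : GammaQ fun i => p i ^ r i) : BraidQuot (numStrings fun i => p i ^ r i)) =
        orbitProd (fun i => p i ^ r i) x := by
  have hm := oddCoprime_prime_pow p r hp hodd hinj hr
  obtain ⟨b, hb⟩ := hm.exists_center_basis
  refine ⟨Module.Free.of_basis b, Module.Finite.of_basis b, ?_, b, hb⟩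
  rw [Module.finrank_eq_card_basis b, hm.card_orbitIndex]
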